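/- Everything is real and $C^\infty$; manifolds are finite-dimensional, Hausdorff and second countable, and vector bundles have finite rank. Let $\mathfrak l$ be a finite-dimensional real Lie algebra, $\mathfrak h\subset\mathfrak l$ a Lie subalgebra, $H$ a Lie group with Lie algebra $\mathfrak h$, and $H\to\mathrm{Aut}(\mathfrak l)$, $h\mapsto\mathrm{Ad}_h$, a smooth group homomorphism that integrates the adjoint action of $\mathfrak h$ on $\mathfrak l$, with $\mathrm{Ad}_h(\mathfrak h)\subseteq\mathfrak h$ for all $h\in H$. *The space.* Let $M$ be an $(\mathfrak l,H)$-space: a manifold with a smooth right $H$-action and a Lie algebra homomorphism $\lambda$, $x\mapsto\lambda_x$, from $\mathfrak l$ to the vector fields on $M$ whose restriction to $\mathfrak h$ is the infinitesimal $H$-action and which satisfies $\lambda_x(mh)=h_*\lambda_{\mathrm{Ad}_hx}(m)$ for all $m\in M$, $x\in\mathfrak l$, $h\in H$. Assume that the $H$-action on $M$ is free and proper, and let $q:M\to M/H$ be the projection. *The Lie algebroid.* Let $A=M\rtimes_{\lambda,H}(\mathfrak l/\mathfrak h)$ be the vector bundle $M\times_H(\mathfrak l/\mathfrak h)$ over $M/H$,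 with $$\Gamma(A)=\{a\in C^\infty(M,\mathfrak l/\mathfrak h) : a(mh)=\mathrm{Ad}_{h^{-1}}a(m)\ \ \forall m\in M,\ h\in H\},$$ with anchor $[m,x+\mathfrak h]\mapsto q_*\lambda_x(m)$ and with bracket $[a,b]=[\tilde a,\tilde b] \bmod \mathfrak h$. Here $\tilde a,\tilde b\in C^\infty(M,\mathfrak l)$ are lifts of $a,b$, and $[\tilde a,\tilde b](m)=[\tilde a(m),\tilde b(m)]+(\lambda_{\tilde a(m)}\tilde b)(m)-(\lambda_{\tilde b(m)}\tilde a)(m)$ is the bracket of the transformation Lie algebroid $M\rtimes_\lambda\mathfrak l$. *The representation.* Let $E\to M$ be an $(\mathfrak l,H)$-vector bundle: an $H$-equivariant vector bundle with a representation of $\mathfrak l$ on $\Gamma(E)$ such that (1) $x\cdot(fs)=\lambda_x(f)s+f(x\cdot s)$ for $x\in\mathfrak l$, $f\in C^\infty(M)$, $s\in\Gamma(E)$; and (2) for the induced action $(hs)(m)=s(mh)h^{-1}$ of $H$ on $\Gamma(E)$, the restriction to $\mathfrak h$ of the $\mathfrak l$-action is the derivative of the $H$-action, and $h(x\cdot(h^{-1}s))=(\mathrm{Ad}_hx)\cdot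 s$ for all $h\in H$, $x\in\mathfrak l$, $s\in\Gamma(E)$. Let $E/H\to M/H$ be the quotient bundle, with $\Gamma(E/H)=\Gamma(E)^H$ and with the representation of $A$ given by $(D_as)(m)=(\tilde a(m)\cdot s)(m)$ for any smooth lift $\tilde a:M\to\mathfrak l$ of $a\in\Gamma(A)$. *The cohomologies.* For a Lie algebra $L$ acting on $V$, let $d$ be the differential $$(dc)(x_0,\dots,x_k)=\sum_j(-1)^jx_j\cdot c(\dots,\hat x_j,\dots)+\sum_{i<j}(-1)^{i+j}c([x_i,x_j],\dots,\hat x_i,\dots,\hat x_j,\dots).$$ The Lie algebroid cohomology $H^\bullet_{\rm Lie}(A;E/H)$ is that of the complex $\Gamma(\mathrm{Hom}(\wedge^\bullet A,E/H))$ of alternating $C^\infty(M/H)$-multilinear maps $\Gamma(A)^\bullet\to\Gamma(E/H)$ under $d$ (with $L=\Gamma(A)$ acting on $V=\Gamma(E/H)$ by $D$). The relative Lie algebra cohomology $H^\bullet_{\rm Lie}(\mathfrak l,H;\Gamma(E))$ is that of the complex $(\wedge^\bullet(\mathfrak l/\mathfrak h)^*\otimes\Gamma(E))^H$ of alternating multilinear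 maps $c:\mathfrak l^\bullet\to\Gamma(E)$ that vanish when an argument lies in $\mathfrak h$ and satisfy $c(\mathrm{Ad}_hx_1,\dots,\mathrm{Ad}_hx_k)=h\,c(x_1,\dots,x_k)$ for all $h\in H$, under $d$ (with $L=\mathfrak l$ and $V=\Gamma(E)$). Then for every $k\ge0$ there is an isomorphism of real vector spaces $$H^k_{\rm Lie}(A;E/H)\;\cong\;H^k_{\rm Lie}(\mathfrak l,H;\Gamma(E)).$$ -/

import Mathlib

set_option linter.unusedSectionVars false
open Bundle VectorField MulOpposite
open scoped Manifold ContDiff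

noncomputable section

/-! ### Chevalley–Eilenberg cohomology -/

section Cohomology

/-- The Chevalley–Eilenberg differential of a real Lie algebra `L` acting on `V`, on arbitrary
functions of `k` arguments:
`(d c)(x₀, …, x_k) = ∑ⱼ (-1)ʲ xⱼ · c(…, x̂ⱼ, …) + ∑_{i<j} (-1)^(i+j) c([xᵢ, xⱼ], …, x̂ᵢ, …, x̂ⱼ, …)`.
The second sum is empty for `k = 0`. In it, the index `i < j` is written as `i.castSucc`, and
`fun r => x (j.succAbove (i.succAbove r))` is the list `x` with the entries `i` and `j` removed. -/
def ceDifferential (L V : Type*) [LieRing L] [LieAlgebra ℝ L] [AddCommGroup V] [Module ℝ V]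
    [LieRingModule L V] [LieModule ℝ L V] :
    (k : ℕ) → ((Fin k → L) → V) →ₗ[ℝ] ((Fin (k + 1) → L) → V)
  | 0 =>
    { toFun := fun c x => ⁅x 0, c fun r => r.elim0⁆
      map_add' := fun c c' => by ext x; simp
      map_smul' := fun t c => by ext x; simp }
  | k + 1 =>
    { toFun := fun c x =>
        ∑ j : Fin (k + 2), (-1 : ℝ) ^ (j : ℕ) • ⁅x j, c fun r => x (j.succAbove r)⁆ +
        ∑ i : Fin (k + 1), ∑ j : Fin (k + 2), if i.castSucc < j then
          (-1 : ℝ) ^ ((i : ℕ) + (j : ℕ)) •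
            c (Fin.cons ⁅x i.castSucc, x j⁆ fun r : Fin k => x (j.succAbove (i.succAbove r)))
        else 0
      map_add' := fun c c' => by
        ext x
        simp only [Pi.add_apply, lie_add, smul_add, Finset.sum_add_distrib, ite_add_zero]
        abel
      map_smul' := fun t c => by
        ext x
        simp only [Pi.smul_apply, lie_smul, RingHom.id_apply, smul_add, Finset.smul_sum,
          smul_ite, smul_zero, smul_comm t] }

/-- The coboundaries of degree `k` of a family `C` of spaces of cochains. -/
def ceCoboundaries {L V : Type*} [LieRing L] [LieAlgebra ℝ L] [AddCommGroup V] [Module ℝ V]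
    [LieRingModule L V] [LieModule ℝ L V] (C : (k : ℕ) → Submodule ℝ ((Fin k → L) → V)) :
    (k : ℕ) → Submodule ℝ ((Fin k → L) → V)
  | 0 => ⊥
  | k + 1 => (C k).map (ceDifferential L V k)

/-- The cocycles of degree `k` of a family `C` of spaces of cochains. -/
def ceCocycles {L V : Type*} [LieRing L] [LieAlgebra ℝ L] [AddCommGroup V] [Module ℝ V]
    [LieRingModule L V] [LieModule ℝ L V] (C : (k : ℕ) → Submodule ℝ ((Fin k → L) → V)) (k : ℕ) :
    Submodule ℝ ((Fin k → L) → V) :=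
  C k ⊓ LinearMap.ker (ceDifferential L V k)

/-- Cocycles modulo coboundaries. -/
abbrev CECohomology {L V : Type*} [LieRing L] [LieAlgebra ℝ L] [AddCommGroup V] [Module ℝ V]
    [LieRingModule L V] [LieModule ℝ L V] (C : (k : ℕ) → Submodule ℝ ((Fin k → L) → V)) (k : ℕ) :=
  ceCocycles C k ⧸ (ceCoboundaries C k).comap (ceCocycles C k).subtype

/-- A representation of a Lie algebroid `A` on a vector bundle `E` over `P`, in terms of
`R = C^∞(P)`, the Lie–Rinehart algebra `L = Γ(A)` over `R`, and the `R`-module `V = Γ(E)`; here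
`D_a s` is `⁅a, s⁆`, and flatness of `D` is the Lie module axiom `leibniz_lie`. -/
class LieAlgebroidRep (R L V : Type*) [CommRing R] [Algebra ℝ R] [LieRing L] [LieAlgebra ℝ L]
    [Module R L] [LieRingModule L R] [LieRinehartRing R L] [LieRinehartAlgebra ℝ R L]
    [AddCommGroup V] [Module ℝ V] [Module R V] [LieRingModule L V] [LieModule ℝ L V] : Prop where
  smul_lie' : ∀ (f : R) (a : L) (s : V), ⁅f • a, s⁆ = f • ⁅a, s⁆
  leibniz' : ∀ (a : L) (f : R) (s : V), ⁅a, f • s⁆ = f • ⁅a, s⁆ + ⁅a, f⁆ • s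

/-- `Γ(Hom(∧ᵏ A, E))`, i.e. the alternating `C^∞(P)`-multilinear maps `Γ(A)ᵏ → Γ(E)`. -/
def lieAlgebroidCochains (R L V : Type*) [CommRing R] [Algebra ℝ R] [AddCommGroup L]
    [Module R L] [AddCommGroup V] [Module ℝ V] [Module R V] [IsScalarTower ℝ R V] (k : ℕ) :
    Submodule ℝ ((Fin k → L) → V) where
  carrier := {c | ∃ φ : L [⋀^Fin k]→ₗ[R] V, ∀ a, c a = φ a}
  add_mem' := by
    rintro c c' ⟨φ, h⟩ ⟨φ', h'⟩
    exact ⟨φ + φ', fun a => by simp [h, h']⟩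
  zero_mem' := ⟨0, fun a => by simp⟩
  smul_mem' := by
    rintro t c ⟨φ, h⟩
    exact ⟨algebraMap ℝ R t • φ, fun a => by simp [h]⟩

/-- The Lie algebroid cohomology `Hᵏ(A; E)`. -/
abbrev LieAlgebroidCohomology (R L V : Type*) [CommRing R] [Algebra ℝ R] [LieRing L]
    [LieAlgebra ℝ L] [Module R L] [LieRingModule L R] [LieRinehartRing R L]
    [LieRinehartAlgebra ℝ R L] [AddCommGroup V] [Module ℝ V] [Module R V] [IsScalarTower ℝ R V]
    [LieRingModule L V] [LieModule ℝ L V] [LieAlgebroidRep R L V] (k : ℕ) :=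
  CECohomology (lieAlgebroidCochains R L V) k

/-- `(∧ᵏ(𝔩/𝔥)^* ⊗ V)^H` as a subspace of `Hom(∧ᵏ 𝔩, V)`: the alternating multilinear maps
`𝔩ᵏ → V` that vanish as soon as one argument lies in `𝔥` and that are `H`-equivariant. -/
def relativeCochains {𝔩 V H : Type*} [LieRing 𝔩] [LieAlgebra ℝ 𝔩] [AddCommGroup V] [Module ℝ V]
    [Group H] (𝔥 : LieSubalgebra ℝ 𝔩) (Ad : Representation ℝ H 𝔩) (ρ : Representation ℝ H V) (k : ℕ) :
    Submodule ℝ ((Fin k → 𝔩) → V) where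
  carrier := {c | (∃ φ : 𝔩 [⋀^Fin k]→ₗ[ℝ] V, ∀ x, c x = φ x) ∧
    (∀ x : Fin k → 𝔩, (∃ i, x i ∈ 𝔥) → c x = 0) ∧
    ∀ (h : H) (x : Fin k → 𝔩), c (fun i => Ad h (x i)) = ρ h (c x)}
  add_mem' := by
    rintro c c' ⟨⟨φ, h⟩, h0, hH⟩ ⟨⟨φ', h'⟩, h0', hH'⟩
    exact ⟨⟨φ + φ', fun a => by simp [h, h']⟩, fun x hx => by simp [h0 x hx, h0' x hx],
      fun g x => by simp [hH, hH']⟩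
  zero_mem' := ⟨⟨0, fun a => by simp⟩, fun _ _ => rfl, fun _ _ => by simp⟩
  smul_mem' := by
    rintro t c ⟨⟨φ, h⟩, h0, hH⟩
    exact ⟨⟨t • φ, fun a => by simp [h]⟩, fun x hx => by simp [h0 x hx], fun g x => by simp [hH]⟩

/-- The Lie algebra cohomology `Hᵏ(𝔩, H; V)` of `𝔩` relative to `H`. -/
abbrev RelativeLieCohomology {𝔩 V H : Type*} [LieRing 𝔩] [LieAlgebra ℝ 𝔩] [AddCommGroup V]
    [Module ℝ V] [LieRingModule 𝔩 V] [LieModule ℝ 𝔩 V] [Group H] (𝔥 : LieSubalgebra ℝ 𝔩)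
    (Ad : Representation ℝ H 𝔩) (ρ : Representation ℝ H V) (k : ℕ) :=
  CECohomology (relativeCochains 𝔥 Ad ρ) k

end Cohomology

section Calculus

variable {EM M : Type*} [NormedAddCommGroup EM] [NormedSpace ℝ EM]
  [TopologicalSpace M]
  [ChartedSpace EM M] [IsManifold 𝓘(ℝ, EM) ∞ M]

/-- directional derivative of a smooth function along a smooth vector field is smooth -/
theorem contMDiff_lieDeriv {f : M → ℝ} (hf : ContMDiff 𝓘(ℝ, EM) 𝓘(ℝ, ℝ) ∞ f)
    {X : ∀ m : M, TangentSpace 𝓘(ℝ, EM) m}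
    (hX : ContMDiff 𝓘(ℝ, EM) 𝓘(ℝ, EM).tangent ∞ (fun m => (⟨m, X m⟩ : TangentBundle 𝓘(ℝ, EM) M))) :
    ContMDiff 𝓘(ℝ, EM) 𝓘(ℝ, ℝ) ∞ (fun m => mvfderiv 𝓘(ℝ, EM) f m (X m)) := by
  have h1 := (hf.contMDiff_tangentMap (m := ∞) (by simp)).comp hX
  have := (contMDiff_snd_tangentBundle_modelSpace ℝ 𝓘(ℝ, ℝ) (n := ∞)).comp h1
  exact this

theorem mvfderiv_mlieBracket [FiniteDimensional ℝ EM] {f : M → ℝ} (hf : ContMDiff 𝓘(ℝ, EM) 𝓘(ℝ, ℝ) ∞ f)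
    {X Y : ∀ m : M, TangentSpace 𝓘(ℝ, EM) m}
    (hX : ContMDiff 𝓘(ℝ, EM) 𝓘(ℝ, EM).tangent ∞ (fun m => (⟨m, X m⟩ : TangentBundle 𝓘(ℝ, EM) M)))
    (hY : ContMDiff 𝓘(ℝ, EM) 𝓘(ℝ, EM).tangent ∞ (fun m => (⟨m, Y m⟩ : TangentBundle 𝓘(ℝ, EM) M)))
    (m : M) :
    mvfderiv 𝓘(ℝ, EM) f m (mlieBracket 𝓘(ℝ, EM) X Y m) =
      mvfderiv 𝓘(ℝ, EM) (fun m' => mvfderiv 𝓘(ℝ, EM) f m' (Y m')) m (X m) -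
      mvfderiv 𝓘(ℝ, EM) (fun m' => mvfderiv 𝓘(ℝ, EM) f m' (X m')) m (Y m) := by
  have hcomp : CompleteSpace EM := FiniteDimensional.complete ℝ EM
  have hle2 : (2 : ℕ∞ω) ≤ ∞ := ENat.LEInfty.out
  have hle3 : (3 : ℕ∞ω) ≤ ∞ := ENat.LEInfty.out
  have : IsManifold 𝓘(ℝ, EM) (minSmoothness ℝ 3) M := by
    rw [minSmoothness_of_isRCLikeNormedField]
    exact IsManifold.of_le hle3
  have : IsManifold 𝓘(ℝ, EM) (minSmoothness ℝ 2) M := by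
    rw [minSmoothness_of_isRCLikeNormedField]
    exact IsManifold.of_le hle2
  have hf1 : ∀ x, MDifferentiableAt 𝓘(ℝ, EM) 𝓘(ℝ, ℝ) f x := hf.mdifferentiable (by simp)
  have hD : ∀ {W : ∀ m : M, TangentSpace 𝓘(ℝ, EM) m}, ContMDiff 𝓘(ℝ, EM) 𝓘(ℝ, EM).tangent ∞
      (fun m => (⟨m, W m⟩ : TangentBundle 𝓘(ℝ, EM) M)) → MDifferentiableAt 𝓘(ℝ, EM) 𝓘(ℝ, ℝ)
      (fun m' => mvfderiv 𝓘(ℝ, EM) f m' (W m')) m :=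
    fun hW => (contMDiff_lieDeriv hf hW).mdifferentiable (by simp) m
  by_cases hz : ∀ z : TangentSpace 𝓘(ℝ, EM) m, z = 0
  · rw [hz (mlieBracket 𝓘(ℝ, EM) X Y m), hz (X m), hz (Y m)]
    simp
  push Not at hz
  obtain ⟨z, hz⟩ := hz
  set Z : ∀ m' : M, TangentSpace 𝓘(ℝ, EM) m' := FiberBundle.extend EM z with hZdef
  have hZm : Z m = z := FiberBundle.extend_apply_self EM z
  obtain ⟨s, hs, hZs⟩ := FiberBundle.exists_contMDiffOn_extend (k := ∞) 𝓘(ℝ, EM) EM z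
  rw [← hZdef] at hZs
  have hZ : ∀ᶠ x in nhds m, ContMDiffAt 𝓘(ℝ, EM) 𝓘(ℝ, EM).tangent ∞
      (fun m => (⟨m, Z m⟩ : TangentBundle 𝓘(ℝ, EM) M)) x := by
    filter_upwards [eventually_mem_nhds_iff.2 hs] with x hx
    exact hZs.contMDiffAt hx
  have hZ0 := hZ.self_of_nhds
  have e1 : ∀ {W : ∀ m : M, TangentSpace 𝓘(ℝ, EM) m}, (mlieBracket 𝓘(ℝ, EM) W (f • Z)) =ᶠ[nhds m]
      (((fun m' => mvfderiv 𝓘(ℝ, EM) f m' (W m')) • Z) + f • mlieBracket 𝓘(ℝ, EM) W Z) := by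
    intro W
    filter_upwards [hZ] with x hx
    exact mlieBracket_smul_right (hf1 x) (hx.mdifferentiableAt (by simp))
  have hB : ∀ {W : ∀ m : M, TangentSpace 𝓘(ℝ, EM) m}, ContMDiff 𝓘(ℝ, EM) 𝓘(ℝ, EM).tangent ∞
      (fun m => (⟨m, W m⟩ : TangentBundle 𝓘(ℝ, EM) M)) →
      MDifferentiableAt 𝓘(ℝ, EM) 𝓘(ℝ, EM).tangent
        (fun m => (⟨m, mlieBracket 𝓘(ℝ, EM) W Z m⟩ : TangentBundle 𝓘(ℝ, EM) M)) m := by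
    intro W hW
    have h3 : IsManifold 𝓘(ℝ, EM) (((2 : ℕ∞) : ℕ∞ω) + 1) M := IsManifold.of_le hle3
    have := ContMDiffAt.mlieBracket_vectorField (m := 1) (n := 2) ((hW m).of_le hle2)
      (hZ0.of_le hle2) (by simp [one_add_one_eq_two])
    exact this.mdifferentiableAt (by simp)
  have e2 : ∀ {U W : ∀ m : M, TangentSpace 𝓘(ℝ, EM) m},
      ContMDiff 𝓘(ℝ, EM) 𝓘(ℝ, EM).tangent ∞ (fun m => (⟨m, W m⟩ : TangentBundle 𝓘(ℝ, EM) M)) →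
      mlieBracket 𝓘(ℝ, EM) U (mlieBracket 𝓘(ℝ, EM) W (f • Z)) m =
      (mvfderiv 𝓘(ℝ, EM) (fun m' => mvfderiv 𝓘(ℝ, EM) f m' (W m')) m (U m) • z +
        mvfderiv 𝓘(ℝ, EM) f m (W m) • mlieBracket 𝓘(ℝ, EM) U Z m) +
      (mvfderiv 𝓘(ℝ, EM) f m (U m) • mlieBracket 𝓘(ℝ, EM) W Z m +
        f m • mlieBracket 𝓘(ℝ, EM) U (mlieBracket 𝓘(ℝ, EM) W Z) m) := by
    intro U W hW
    have hZ1 := hZ0.mdifferentiableAt (by simp)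
    rw [Filter.EventuallyEq.mlieBracket_vectorField_eq (Filter.EventuallyEq.refl _ U) e1,
      mlieBracket_add_right, mlieBracket_smul_right (hD hW) hZ1,
      mlieBracket_smul_right (hf1 m) (hB hW), hZm]
    · exact MDifferentiableAt.smul_section (hD hW) hZ1
    · exact MDifferentiableAt.smul_section (hf1 m) (hB hW)
  have hfZ : ContMDiffAt 𝓘(ℝ, EM) 𝓘(ℝ, EM).tangent ∞
      (fun m => (⟨m, (f • Z) m⟩ : TangentBundle 𝓘(ℝ, EM) M)) m :=
    ContMDiffAt.smul_section (hf m) hZ0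
  have J1 := leibniz_identity_mlieBracket_apply (I := 𝓘(ℝ, EM)) ((hX m).of_le (by simpa using! hle2))
    ((hY m).of_le (by simpa using! hle2)) (hZ0.of_le (by simpa using! hle2))
  have J2 := leibniz_identity_mlieBracket_apply (I := 𝓘(ℝ, EM)) ((hX m).of_le (by simpa using! hle2))
    ((hY m).of_le (by simpa using! hle2)) (hfZ.of_le (by simpa using! hle2))
  rw [e2 hY, e2 hX, e1.self_of_nhds] at J2
  simp only [Pi.add_apply, Pi.smul_apply', hZm, J1, smul_add] at J2
  rw [← sub_eq_zero] at J2 ⊢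
  refine (smul_eq_zero.1 (?_ : _ • z = 0)).resolve_right hz
  rw [← neg_eq_zero, ← J2]
  module

section VectorValued

variable {V W U : Type*} [AddCommGroup V] [Module ℝ V] [FiniteDimensional ℝ V]
  [AddCommGroup W] [Module ℝ W] [FiniteDimensional ℝ W]
  [AddCommGroup U] [Module ℝ U] [FiniteDimensional ℝ U]

variable (EM) in
/-- Smoothness of a map from a manifold to a finite-dimensional real vector space. -/
def SmoothInto (a : M → V) : Prop :=
  ∀ φ : Module.Dual ℝ V, ContMDiff 𝓘(ℝ, EM) 𝓘(ℝ, ℝ) ∞ (fun m => φ (a m))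

/-- The derivative at `m`, in the direction of the tangent vector `X`, of a map from a manifold to a
finite-dimensional real vector space, computed in a basis. -/
def dirDeriv (a : M → V) (m : M) (X : TangentSpace 𝓘(ℝ, EM) m) : V :=
  ∑ i, mvfderiv 𝓘(ℝ, EM) (fun m' => (Module.finBasis ℝ V).coord i (a m')) m X •
    Module.finBasis ℝ V i

theorem ext_dual {x y : V} (h : ∀ φ : Module.Dual ℝ V, φ x = φ y) : x = y := by
  rw [← sub_eq_zero, ← Module.forall_dual_apply_eq_zero_iff ℝ]
  intro φ
  rw [map_sub, h, sub_self]

theorem sum_coord_smul {U : Type*} [AddCommGroup U] [Module ℝ U] (T : V →ₗ[ℝ] U) (v : V) :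
    T v = ∑ i, (Module.finBasis ℝ V).coord i v • T (Module.finBasis ℝ V i) := by
  conv_lhs => rw [← (Module.finBasis ℝ V).sum_repr v]
  simp only [map_sum, map_smul, Module.Basis.coord_apply]

theorem SmoothInto.mdiff {a : M → V} (ha : SmoothInto EM a) (φ : Module.Dual ℝ V) (m : M) :
    MDifferentiableAt 𝓘(ℝ, EM) 𝓘(ℝ, ℝ) (fun m => φ (a m)) m :=
  (ha φ).mdifferentiable (by simp) m

theorem mvfderiv_sum' {ι : Type*} (s : Finset ι) {g : ι → M → ℝ} {m : M}
    (hg : ∀ i ∈ s, MDifferentiableAt 𝓘(ℝ, EM) 𝓘(ℝ, ℝ) (g i) m) :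
    MDifferentiableAt 𝓘(ℝ, EM) 𝓘(ℝ, ℝ) (fun m' => ∑ i ∈ s, g i m') m ∧
    mvfderiv 𝓘(ℝ, EM) (fun m' => ∑ i ∈ s, g i m') m = ∑ i ∈ s, mvfderiv 𝓘(ℝ, EM) (g i) m := by
  classical
  induction s using Finset.induction_on with
  | empty =>
    simp only [Finset.sum_empty]
    exact ⟨mdifferentiableAt_const, mvfderiv_const _⟩
  | insert i s hi ih =>
    obtain ⟨h1, h2⟩ := ih fun j hj => hg j (Finset.mem_insert_of_mem hj)
    have h3 := hg i (Finset.mem_insert_self i s)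
    simp only [Finset.sum_insert hi]
    exact ⟨h3.add h1, by rw [← h2]; exact mvfderiv_add h3 h1⟩

theorem dual_dirDeriv {a : M → V} (ha : SmoothInto EM a) (φ : Module.Dual ℝ V) (m : M)
    (X : TangentSpace 𝓘(ℝ, EM) m) :
    φ (dirDeriv a m X) = mvfderiv 𝓘(ℝ, EM) (fun m' => φ (a m')) m X := by
  have h : (fun m' => φ (a m')) = fun m' => ∑ i,
      ((fun m' => (Module.finBasis ℝ V).coord i (a m') : M → ℝ) *
        (fun _ => φ (Module.finBasis ℝ V i) : M → ℝ)) m' := by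
    ext m'
    exact sum_coord_smul φ (a m')
  rw [h, (mvfderiv_sum' _ fun i _ => MDifferentiableAt.mul
    (ha.mdiff ((Module.finBasis ℝ V).coord i) m) mdifferentiableAt_const).2]
  simp only [dirDeriv, map_sum, map_smul, sum_apply]
  refine Finset.sum_congr rfl fun i _ => ?_
  rw [mvfderiv_mul (ha.mdiff ((Module.finBasis ℝ V).coord i) m) mdifferentiableAt_const,
    mvfderiv_const]
  simp [mul_comm]

theorem dirDeriv_eq_of_dual {a : M → V} (ha : SmoothInto EM a) {m : M}
    {X : TangentSpace 𝓘(ℝ, EM) m} {v : V}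
    (h : ∀ φ : Module.Dual ℝ V, mvfderiv 𝓘(ℝ, EM) (fun m' => φ (a m')) m X = φ v) :
    dirDeriv a m X = v :=
  ext_dual fun φ => by rw [dual_dirDeriv ha, h]

@[simp] theorem dirDeriv_add_vec (a : M → V) (m : M) (X Y : TangentSpace 𝓘(ℝ, EM) m) :
    dirDeriv a m (X + Y) = dirDeriv a m X + dirDeriv a m Y := by
  simp [dirDeriv, add_smul, Finset.sum_add_distrib]

@[simp] theorem dirDeriv_smul_vec (a : M → V) (m : M) (t : ℝ) (X : TangentSpace 𝓘(ℝ, EM) m) :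
    dirDeriv a m (t • X) = t • dirDeriv a m X := by
  simp [dirDeriv, mul_smul, Finset.smul_sum]

theorem SmoothInto.const (v : V) : SmoothInto EM (fun _ : M => v) := fun _ => contMDiff_const

theorem SmoothInto.add {a b : M → V} (ha : SmoothInto EM a) (hb : SmoothInto EM b) :
    SmoothInto EM (fun m => a m + b m) := fun φ => by
  simp only [map_add]; exact (ha φ).add (hb φ)

theorem SmoothInto.linear {a : M → V} (ha : SmoothInto EM a) (T : V →ₗ[ℝ] W) :
    SmoothInto EM (fun m => T (a m)) := fun φ => ha (φ ∘ₗ T)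

theorem SmoothInto.smul {f : M → ℝ} (hf : ContMDiff 𝓘(ℝ, EM) 𝓘(ℝ, ℝ) ∞ f) {a : M → V}
    (ha : SmoothInto EM a) : SmoothInto EM (fun m => f m • a m) := fun φ => by
  simp only [map_smul]; exact hf.mul (ha φ)

theorem SmoothInto.sub {a b : M → V} (ha : SmoothInto EM a) (hb : SmoothInto EM b) :
    SmoothInto EM (fun m => a m - b m) := fun φ => by
  simp only [map_sub]; exact (ha φ).sub (hb φ)

theorem SmoothInto.sum {ι : Type*} (s : Finset ι) {a : ι → M → V}
    (ha : ∀ i ∈ s, SmoothInto EM (a i)) : SmoothInto EM (fun m => ∑ i ∈ s, a i m) := fun φ => by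
  simp only [map_sum]; exact contMDiff_finsetSum fun i hi => ha i hi φ

theorem SmoothInto.bilin {a : M → V} {b : M → W} (ha : SmoothInto EM a) (hb : SmoothInto EM b)
    (B : V →ₗ[ℝ] W →ₗ[ℝ] U) : SmoothInto EM (fun m => B (a m) (b m)) := by
  have : (fun m => B (a m) (b m)) =
      fun m => ∑ i, (Module.finBasis ℝ V).coord i (a m) • B (Module.finBasis ℝ V i) (b m) := by
    ext m
    exact sum_coord_smul (B.flip (b m)) (a m)
  rw [this]
  exact .sum _ fun i _ => .smul (ha _) (hb.linear _)

theorem dirDeriv_add {a b : M → V} (ha : SmoothInto EM a) (hb : SmoothInto EM b) (m : M)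
    (X : TangentSpace 𝓘(ℝ, EM) m) :
    dirDeriv (fun m => a m + b m) m X = dirDeriv a m X + dirDeriv b m X :=
  dirDeriv_eq_of_dual (ha.add hb) fun φ => by
    rw [map_add, dual_dirDeriv ha, dual_dirDeriv hb]
    simp only [map_add]
    exact congrArg (· X) (mvfderiv_add (ha.mdiff φ m) (hb.mdiff φ m))

theorem dirDeriv_linear {a : M → V} (ha : SmoothInto EM a) (T : V →ₗ[ℝ] W) (m : M)
    (X : TangentSpace 𝓘(ℝ, EM) m) :
    dirDeriv (fun m => T (a m)) m X = T (dirDeriv a m X) :=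
  dirDeriv_eq_of_dual (ha.linear T) fun φ => (dual_dirDeriv ha (φ ∘ₗ T) m X).symm

theorem dirDeriv_smul {f : M → ℝ} (hf : ContMDiff 𝓘(ℝ, EM) 𝓘(ℝ, ℝ) ∞ f) {a : M → V}
    (ha : SmoothInto EM a) (m : M) (X : TangentSpace 𝓘(ℝ, EM) m) :
    dirDeriv (fun m => f m • a m) m X =
      mvfderiv 𝓘(ℝ, EM) f m X • a m + f m • dirDeriv a m X :=
  dirDeriv_eq_of_dual (.smul hf ha) fun φ => by
    simp only [map_add, map_smul, dual_dirDeriv ha, smul_eq_mul]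
    have := congrArg (· X) (mvfderiv_mul (hf.mdifferentiable (by simp) m) (ha.mdiff φ m))
    simp only [Pi.mul_def] at this
    rw [this]
    simp
    ring

theorem dirDeriv_sum {ι : Type*} (s : Finset ι) {a : ι → M → V}
    (ha : ∀ i ∈ s, SmoothInto EM (a i)) (m : M) (X : TangentSpace 𝓘(ℝ, EM) m) :
    dirDeriv (fun m => ∑ i ∈ s, a i m) m X = ∑ i ∈ s, dirDeriv (a i) m X :=
  dirDeriv_eq_of_dual (.sum s ha) fun φ => by
    simp only [map_sum]
    rw [(mvfderiv_sum' s fun i hi => (ha i hi).mdiff φ m).2]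
    simp only [sum_apply]
    exact Finset.sum_congr rfl fun i hi => (dual_dirDeriv (ha i hi) φ m X).symm

theorem dirDeriv_bilin {a : M → V} {b : M → W} (ha : SmoothInto EM a) (hb : SmoothInto EM b)
    (B : V →ₗ[ℝ] W →ₗ[ℝ] U) (m : M) (X : TangentSpace 𝓘(ℝ, EM) m) :
    dirDeriv (fun m => B (a m) (b m)) m X = B (dirDeriv a m X) (b m) + B (a m) (dirDeriv b m X) := by
  have : (fun m => B (a m) (b m)) =
      fun m => ∑ i, (Module.finBasis ℝ V).coord i (a m) • B (Module.finBasis ℝ V i) (b m) := by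
    ext m
    exact sum_coord_smul (B.flip (b m)) (a m)
  rw [this, dirDeriv_sum _ fun i _ => .smul (ha _) (hb.linear _)]
  simp only [dirDeriv_smul (ha _) (hb.linear _), dirDeriv_linear hb, Finset.sum_add_distrib]
  congr 1
  · simp [dirDeriv]
  · exact (sum_coord_smul (B.flip (dirDeriv b m X)) (a m)).symm

theorem dirDeriv_const (v : V) (m : M) (X : TangentSpace 𝓘(ℝ, EM) m) :
    dirDeriv (fun _ : M => v) m X = 0 := by
  simp [dirDeriv, mvfderiv_const]

end VectorValued

end Calculus

section Setting

variable {𝔩 : Type*} [LieRing 𝔩] [LieAlgebra ℝ 𝔩]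

/-- A Lie group `H` with Lie algebra `𝔥 ⊆ 𝔩` (through the identification `ι`), together with a group
homomorphism `Ad : H → Aut(𝔩)`, preserving `𝔥` and integrating the adjoint action of `𝔥` on `𝔩`. -/
structure LieGroupPair (𝔥 : LieSubalgebra ℝ 𝔩) (EH H : Type*) [NormedAddCommGroup EH]
    [NormedSpace ℝ EH] [TopologicalSpace H] [ChartedSpace EH H] [Group H] where
  /-- the identification of the Lie algebra of `H` with `𝔥` -/
  ι : GroupLieAlgebra 𝓘(ℝ, EH) H ≃ₗ[ℝ] 𝔥
  ι_lie : ∀ v w, ι ⁅v, w⁆ = ⁅ι v, ι w⁆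
  /-- the action of `H` on `𝔩` -/
  Ad : Representation ℝ H 𝔩
  Ad_lie : ∀ h x y, Ad h ⁅x, y⁆ = ⁅Ad h x, Ad h y⁆
  Ad_mem : ∀ h, ∀ x ∈ 𝔥, Ad h x ∈ 𝔥
  Ad_smooth : ∀ x : 𝔩, SmoothInto EH (fun h : H => Ad h x)
  /-- the derivative of `h ↦ Ad_h x` at `1` in the direction `v` is `[ι v, x]` -/
  Ad_deriv : ∀ (v : GroupLieAlgebra 𝓘(ℝ, EH) H) (x : 𝔩) (φ : Module.Dual ℝ 𝔩),
    mvfderiv 𝓘(ℝ, EH) (fun h : H => φ (Ad h x)) 1 v = φ ⁅(ι v : 𝔩), x⁆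

variable {𝔥 : LieSubalgebra ℝ 𝔩} {EH H : Type*} [NormedAddCommGroup EH]
    [NormedSpace ℝ EH] [TopologicalSpace H] [ChartedSpace EH H] [Group H]

/-- An `(𝔩, H)`-space structure on a manifold `M` with a right action of `H`, written
`m h = op h • m`. -/
structure LHSpace (P : LieGroupPair 𝔥 EH H) (EM M : Type*) [NormedAddCommGroup EM]
    [NormedSpace ℝ EM] [TopologicalSpace M] [ChartedSpace EM M] [IsManifold 𝓘(ℝ, EM) ∞ M]
    [MulAction Hᵐᵒᵖ M] where
  smooth_act : ContMDiff (𝓘(ℝ, EM).prod 𝓘(ℝ, EH)) 𝓘(ℝ, EM) ∞ (fun p : M × H => op p.2 • p.1)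
  /-- the vector field `λ_x` -/
  lam : 𝔩 →ₗ[ℝ] ((m : M) → TangentSpace 𝓘(ℝ, EM) m)
  lam_smooth : ∀ x, ContMDiff 𝓘(ℝ, EM) 𝓘(ℝ, EM).tangent ∞
    (fun m => (⟨m, lam x m⟩ : TangentBundle 𝓘(ℝ, EM) M))
  lam_lie : ∀ x y, lam ⁅x, y⁆ = mlieBracket 𝓘(ℝ, EM) (lam x) (lam y)
  /-- `λ_x`, for `x ∈ 𝔥`, is the infinitesimal action -/
  lam_infinitesimal : ∀ (v : GroupLieAlgebra 𝓘(ℝ, EH) H) (m : M),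
    lam (P.ι v) m = mfderiv 𝓘(ℝ, EH) 𝓘(ℝ, EM) (fun h : H => op h • m) 1 v
  /-- `λ_x(m h) = h_* λ_{Ad_h x}(m)` -/
  lam_equivariant : ∀ (m : M) (x : 𝔩) (h : H),
    lam x (op h • m) =
      mfderiv 𝓘(ℝ, EM) 𝓘(ℝ, EM) (fun m' : M => op h • m') m (lam (P.Ad h x) m)

namespace LHSpace

variable [FiniteDimensional ℝ 𝔩] [LieGroup 𝓘(ℝ, EH) ∞ H] {P : LieGroupPair 𝔥 EH H} {EM M : Type*} [NormedAddCommGroup EM]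
    [NormedSpace ℝ EM] [FiniteDimensional ℝ EM]
    [TopologicalSpace M] [ChartedSpace EM M] [IsManifold 𝓘(ℝ, EM) ∞ M]
    [MulAction Hᵐᵒᵖ M] (S : LHSpace P EM M)
    {V W U : Type*} [AddCommGroup V] [Module ℝ V] [FiniteDimensional ℝ V]
    [AddCommGroup W] [Module ℝ W] [FiniteDimensional ℝ W]
    [AddCommGroup U] [Module ℝ U] [FiniteDimensional ℝ U]

/-- The action of a section `a` of the transformation Lie algebroid `M ⋊_λ 𝔩` on vector-valued
functions through the anchor `(m, x) ↦ λ_x(m)`. -/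
def anchorDeriv (a : M → 𝔩) (c : M → V) (m : M) : V := dirDeriv c m (S.lam (a m) m)

/-- The bracket of the transformation Lie algebroid `M ⋊_λ 𝔩` on its sections, i.e. on functions
`M → 𝔩`. It is the one that satisfies the Leibniz rule and is the bracket of `𝔩` on constants. -/
def transBracket (a b : M → 𝔩) (m : M) : 𝔩 :=
  ⁅a m, b m⁆ + S.anchorDeriv a b m - S.anchorDeriv b a m

theorem transBracket_const (x y : 𝔩) :
    S.transBracket (fun _ => x) (fun _ => y) = fun _ => ⁅x, y⁆ := by
  ext m
  simp [transBracket, anchorDeriv, dirDeriv_const]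

theorem lam_sum (x : 𝔩) (m : M) : S.lam x m =
    ∑ i, (Module.finBasis ℝ 𝔩).coord i x • S.lam (Module.finBasis ℝ 𝔩 i) m :=
  sum_coord_smul ((LinearMap.proj m : _ →ₗ[ℝ] TangentSpace 𝓘(ℝ, EM) m) ∘ₗ S.lam) x

theorem smooth_anchor_fun {a : M → 𝔩} (ha : SmoothInto EM a) {f : M → ℝ}
    (hf : ContMDiff 𝓘(ℝ, EM) 𝓘(ℝ, ℝ) ∞ f) :
    ContMDiff 𝓘(ℝ, EM) 𝓘(ℝ, ℝ) ∞ (fun m => mvfderiv 𝓘(ℝ, EM) f m (S.lam (a m) m)) := by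
  have : (fun m => mvfderiv 𝓘(ℝ, EM) f m (S.lam (a m) m)) = fun m =>
      ∑ i, (Module.finBasis ℝ 𝔩).coord i (a m) *
        mvfderiv 𝓘(ℝ, EM) f m (S.lam (Module.finBasis ℝ 𝔩 i) m) := by
    ext m
    rw [S.lam_sum]
    simp
  rw [this]
  exact contMDiff_finsetSum fun i _ => (ha _).mul (contMDiff_lieDeriv hf (S.lam_smooth _))

theorem smooth_anchorDeriv {a : M → 𝔩} (ha : SmoothInto EM a) {c : M → V}
    (hc : SmoothInto EM c) : SmoothInto EM (S.anchorDeriv a c) := fun φ => by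
  simp only [anchorDeriv, dual_dirDeriv hc]
  exact S.smooth_anchor_fun ha (hc φ)

variable (𝔩) in
/-- the bracket of `𝔩` as a bilinear map -/
def lieBilin : 𝔩 →ₗ[ℝ] 𝔩 →ₗ[ℝ] 𝔩 :=
  LinearMap.mk₂ ℝ (fun x y => ⁅x, y⁆) (fun _ _ _ => add_lie _ _ _) (fun _ _ _ => smul_lie _ _ _)
    (fun _ _ _ => lie_add _ _ _) (fun _ _ _ => lie_smul _ _ _)

theorem smooth_transBracket {a b : M → 𝔩} (ha : SmoothInto EM a) (hb : SmoothInto EM b) :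
    SmoothInto EM (S.transBracket a b) :=
  ((ha.bilin hb (lieBilin 𝔩)).add (S.smooth_anchorDeriv ha hb)).sub (S.smooth_anchorDeriv hb ha)

/-- The second derivative of a function along two sections. -/
theorem anchor_anchor_fun {a b : M → 𝔩} (hb : SmoothInto EM b) {f : M → ℝ}
    (hf : ContMDiff 𝓘(ℝ, EM) 𝓘(ℝ, ℝ) ∞ f) (m : M) :
    mvfderiv 𝓘(ℝ, EM) (fun m' => mvfderiv 𝓘(ℝ, EM) f m' (S.lam (b m') m')) m (S.lam (a m) m) =
      mvfderiv 𝓘(ℝ, EM) f m (S.lam (S.anchorDeriv a b m) m) +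
      mvfderiv 𝓘(ℝ, EM) (fun m' => mvfderiv 𝓘(ℝ, EM) f m' (S.lam (b m) m')) m (S.lam (a m) m) := by
  have key : ∀ c : M → 𝔩, (fun m' => mvfderiv 𝓘(ℝ, EM) f m' (S.lam (c m') m')) = fun m' =>
      ∑ i, (((fun m' => (Module.finBasis ℝ 𝔩).coord i (c m')) : M → ℝ) *
        (fun m' => mvfderiv 𝓘(ℝ, EM) f m' (S.lam (Module.finBasis ℝ 𝔩 i) m') : M → ℝ)) m' := by
    intro c
    ext m'
    rw [S.lam_sum]
    simp
  have hd : ∀ i, MDifferentiableAt 𝓘(ℝ, EM) 𝓘(ℝ, ℝ)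
      (fun m' => mvfderiv 𝓘(ℝ, EM) f m' (S.lam (Module.finBasis ℝ 𝔩 i) m')) m := fun i =>
    (contMDiff_lieDeriv hf (S.lam_smooth _)).mdifferentiable (by simp) m
  have key2 : ∀ c : M → 𝔩, SmoothInto EM c →
      mvfderiv 𝓘(ℝ, EM) (fun m' => mvfderiv 𝓘(ℝ, EM) f m' (S.lam (c m') m')) m (S.lam (a m) m) =
      ∑ i, ((Module.finBasis ℝ 𝔩).coord i (c m) *
        mvfderiv 𝓘(ℝ, EM) (fun m' => mvfderiv 𝓘(ℝ, EM) f m' (S.lam (Module.finBasis ℝ 𝔩 i) m')) m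
          (S.lam (a m) m) +
        mvfderiv 𝓘(ℝ, EM) f m (S.lam (Module.finBasis ℝ 𝔩 i) m) *
        (Module.finBasis ℝ 𝔩).coord i (dirDeriv c m (S.lam (a m) m))) := by
    intro c hc
    rw [key c, (mvfderiv_sum' _ fun i _ => MDifferentiableAt.mul
      (hc.mdiff ((Module.finBasis ℝ 𝔩).coord i) m) (hd i)).2, sum_apply]
    refine Finset.sum_congr rfl fun i _ => ?_
    rw [mvfderiv_mul (hc.mdiff ((Module.finBasis ℝ 𝔩).coord i) m) (hd i), dual_dirDeriv hc]
    simp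
  rw [key2 b hb, key2 (fun _ => b m) (.const _), anchorDeriv, S.lam_sum (dirDeriv b m _)]
  simp only [Finset.sum_add_distrib, dirDeriv_const, map_zero, mul_zero,
    add_zero, map_sum, map_smul, smul_eq_mul]
  rw [add_comm]
  congr 1
  exact Finset.sum_congr rfl fun i _ => mul_comm _ _

/-- The anchor of `M ⋊_λ 𝔩` is compatible with brackets. -/
theorem anchor_transBracket_fun {a b : M → 𝔩} (ha : SmoothInto EM a) (hb : SmoothInto EM b)
    {f : M → ℝ} (hf : ContMDiff 𝓘(ℝ, EM) 𝓘(ℝ, ℝ) ∞ f) (m : M) :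
    mvfderiv 𝓘(ℝ, EM) f m (S.lam (S.transBracket a b m) m) =
      mvfderiv 𝓘(ℝ, EM) (fun m' => mvfderiv 𝓘(ℝ, EM) f m' (S.lam (b m') m')) m (S.lam (a m) m) -
      mvfderiv 𝓘(ℝ, EM) (fun m' => mvfderiv 𝓘(ℝ, EM) f m' (S.lam (a m') m')) m (S.lam (b m) m) := by
  rw [S.anchor_anchor_fun hb hf, S.anchor_anchor_fun ha hf, transBracket, map_sub, map_add,
    S.lam_lie, Pi.sub_apply, Pi.add_apply, map_sub, map_add,
    mvfderiv_mlieBracket hf (S.lam_smooth _) (S.lam_smooth _)]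
  ring

theorem anchorDeriv_transBracket {a b : M → 𝔩} (ha : SmoothInto EM a) (hb : SmoothInto EM b)
    {c : M → V} (hc : SmoothInto EM c) (m : M) :
    S.anchorDeriv (S.transBracket a b) c m =
      S.anchorDeriv a (S.anchorDeriv b c) m - S.anchorDeriv b (S.anchorDeriv a c) m := by
  refine ext_dual fun φ => ?_
  have e : ∀ {u : M → 𝔩}, (fun m' => φ (S.anchorDeriv u c m')) =
      fun m' => mvfderiv 𝓘(ℝ, EM) (fun m => φ (c m)) m' (S.lam (u m') m') := by
    intro u
    ext m'
    exact dual_dirDeriv hc φ _ _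
  rw [map_sub, anchorDeriv, anchorDeriv, anchorDeriv, dual_dirDeriv hc,
    dual_dirDeriv (S.smooth_anchorDeriv hb hc), dual_dirDeriv (S.smooth_anchorDeriv ha hc), e, e]
  exact S.anchor_transBracket_fun ha hb (hc φ) m

theorem anchorDeriv_add_left (a b : M → 𝔩) (c : M → V) (m : M) :
    S.anchorDeriv (fun m => a m + b m) c m = S.anchorDeriv a c m + S.anchorDeriv b c m := by
  simp [anchorDeriv]

theorem anchorDeriv_lie {a b c : M → 𝔩} (hb : SmoothInto EM b) (hc : SmoothInto EM c) (m : M) :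
    S.anchorDeriv a (fun m => ⁅b m, c m⁆) m =
      ⁅S.anchorDeriv a b m, c m⁆ + ⁅b m, S.anchorDeriv a c m⁆ :=
  dirDeriv_bilin hb hc (lieBilin 𝔩) m _

theorem _root_.dirDeriv_sub {a b : M → V} (ha : SmoothInto EM a) (hb : SmoothInto EM b) (m : M)
    (X : TangentSpace 𝓘(ℝ, EM) m) :
    dirDeriv (fun m => a m - b m) m X = dirDeriv a m X - dirDeriv b m X := by
  have := dirDeriv_add (ha.sub hb) hb m X
  simp only [sub_add_cancel] at this
  rw [this, add_sub_cancel_right]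

theorem anchorDeriv_transBracket_right {a b c : M → 𝔩} (hb : SmoothInto EM b)
    (hc : SmoothInto EM c) (m : M) :
    S.anchorDeriv a (S.transBracket b c) m =
      ⁅S.anchorDeriv a b m, c m⁆ + ⁅b m, S.anchorDeriv a c m⁆ +
      S.anchorDeriv a (S.anchorDeriv b c) m - S.anchorDeriv a (S.anchorDeriv c b) m := by
  rw [← S.anchorDeriv_lie hb hc]
  have h1 : SmoothInto EM (fun m => ⁅b m, c m⁆) := hb.bilin hc (lieBilin 𝔩)
  have h2 := S.smooth_anchorDeriv hb hc
  exact (dirDeriv_sub (h1.add h2) (S.smooth_anchorDeriv hc hb) m _).trans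
    (by rw [dirDeriv_add h1 h2]; rfl)

theorem transBracket_jacobi {a b c : M → 𝔩} (ha : SmoothInto EM a) (hb : SmoothInto EM b)
    (hc : SmoothInto EM c) (m : M) :
    S.transBracket a (S.transBracket b c) m =
      S.transBracket (S.transBracket a b) c m + S.transBracket b (S.transBracket a c) m := by
  have T : ∀ (u v : M → 𝔩) (m : M), S.transBracket u v m =
    ⁅u m, v m⁆ + S.anchorDeriv u v m - S.anchorDeriv v u m := fun _ _ _ => rfl
  rw [T a (S.transBracket b c), T (S.transBracket a b) c, T b (S.transBracket a c), S.anchorDeriv_transBracket_right hb hc,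
    S.anchorDeriv_transBracket_right ha hc, S.anchorDeriv_transBracket_right ha hb,
    S.anchorDeriv_transBracket ha hb hc, S.anchorDeriv_transBracket hb hc ha,
    S.anchorDeriv_transBracket ha hc hb]
  simp only [transBracket, lie_add, lie_sub, add_lie, sub_lie]
  rw [leibniz_lie (a m) (b m) (c m), ← lie_skew (S.anchorDeriv c a m) (b m)]
  abel

/-! The quotient Lie algebroid -/

theorem _root_.LieGroupPair.Ad_inv_deriv (P : LieGroupPair 𝔥 EH H)
    (v : GroupLieAlgebra 𝓘(ℝ, EH) H) (x : 𝔩) (φ : Module.Dual ℝ 𝔩) :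
    MDifferentiable 𝓘(ℝ, EH) 𝓘(ℝ, ℝ) (fun h : H => φ (P.Ad h⁻¹ x)) ∧
    mvfderiv 𝓘(ℝ, EH) (fun h : H => φ (P.Ad h⁻¹ x)) 1 v = -φ ⁅(P.ι v : 𝔩), x⁆ := by
  have hs : ∀ ψ : Module.Dual ℝ 𝔩, MDifferentiable 𝓘(ℝ, EH) 𝓘(ℝ, ℝ)
      (fun h : H => ψ (P.Ad h⁻¹ x)) := fun ψ =>
    ((P.Ad_smooth x ψ).comp (contMDiff_inv 𝓘(ℝ, EH) ∞)).mdifferentiable (by simp)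
  refine ⟨hs φ, ?_⟩
  set b := Module.finBasis ℝ 𝔩
  have hs' : ∀ i, MDifferentiableAt 𝓘(ℝ, EH) 𝓘(ℝ, ℝ) (fun h : H => φ (P.Ad h (b i))) 1 := fun i =>
    (P.Ad_smooth (b i) φ).mdifferentiable (by simp) 1
  have h0 : (fun h : H => ∑ i, (((fun h => b.coord i (P.Ad h⁻¹ x)) : H → ℝ) *
      (fun h => φ (P.Ad h (b i)) : H → ℝ)) h) = fun _ => φ x := by
    ext h
    have := sum_coord_smul (φ ∘ₗ P.Ad h) (P.Ad h⁻¹ x)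
    rw [LinearMap.comp_apply, ← Module.End.mul_apply, ← map_mul, mul_inv_cancel, map_one,
      Module.End.one_apply] at this
    exact this.symm
  have h1 := congrArg (fun L : H → ℝ => mvfderiv 𝓘(ℝ, EH) L 1 v) h0
  simp only [mvfderiv_const] at h1
  have e1 := (mvfderiv_sum' (EM := EH) (m := (1 : H)) Finset.univ
    (g := fun i => ((fun h => b.coord i (P.Ad h⁻¹ x)) : H → ℝ) * (fun h => φ (P.Ad h (b i)) : H → ℝ))
    fun i _ => MDifferentiableAt.mul (hs (b.coord i) 1) (hs' i)).2
  rw [e1, sum_apply] at h1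
  have h2 : (fun h : H => φ (P.Ad h⁻¹ x)) = fun h => ∑ i,
      (((fun h => b.coord i (P.Ad h⁻¹ x)) : H → ℝ) * (fun _ => φ (b i) : H → ℝ)) h := by
    ext h
    exact sum_coord_smul φ _
  have h3 : ∀ i, mvfderiv 𝓘(ℝ, EH) (((fun h => b.coord i (P.Ad h⁻¹ x)) : H → ℝ) *
      (fun h => φ (P.Ad h (b i)) : H → ℝ)) 1 v = b.coord i x * φ ⁅(P.ι v : 𝔩), b i⁆ +
      φ (b i) * mvfderiv 𝓘(ℝ, EH) (fun h => b.coord i (P.Ad h⁻¹ x) : H → ℝ) 1 v := fun i => by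
    rw [mvfderiv_mul (hs (b.coord i) 1) (hs' i), add_apply, smul_apply, smul_apply, P.Ad_deriv]
    simp
  have h4 : ∀ i, mvfderiv 𝓘(ℝ, EH) (((fun h => b.coord i (P.Ad h⁻¹ x)) : H → ℝ) *
      (fun _ => φ (b i) : H → ℝ)) 1 v =
      φ (b i) * mvfderiv 𝓘(ℝ, EH) (fun h => b.coord i (P.Ad h⁻¹ x) : H → ℝ) 1 v := fun i => by
    rw [mvfderiv_mul (hs (b.coord i) 1) mdifferentiableAt_const, add_apply, smul_apply,
      smul_apply, mvfderiv_const]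
    simp
  have h5 : ∑ i, b.coord i x * φ ⁅(P.ι v : 𝔩), b i⁆ = φ ⁅(P.ι v : 𝔩), x⁆ :=
    (sum_coord_smul (φ ∘ₗ lieBilin 𝔩 (P.ι v)) x).symm
  have e2 := (mvfderiv_sum' (EM := EH) (m := (1 : H)) Finset.univ
    (g := fun i => ((fun h => b.coord i (P.Ad h⁻¹ x)) : H → ℝ) * (fun _ => φ (b i) : H → ℝ))
    fun i _ => MDifferentiableAt.mul (hs (b.coord i) 1) mdifferentiableAt_const).2
  rw [h2, e2, sum_apply]
  simp only [h3, h4, Finset.sum_add_distrib, h5] at h1 ⊢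
  rw [eq_neg_iff_add_eq_zero, add_comm]
  simpa using h1

/-- The action of `H` on `𝔩/𝔥`. -/
def _root_.LieGroupPair.quotAd (P : LieGroupPair 𝔥 EH H) (h : H) :
    (𝔩 ⧸ 𝔥.toSubmodule) →ₗ[ℝ] (𝔩 ⧸ 𝔥.toSubmodule) :=
  Submodule.mapQ _ _ (P.Ad h) fun x hx => P.Ad_mem h x hx

theorem _root_.LieGroupPair.quotAd_mk (P : LieGroupPair 𝔥 EH H) (h : H) (x : 𝔩) :
    P.quotAd h (𝔥.toSubmodule.mkQ x) = 𝔥.toSubmodule.mkQ (P.Ad h x) := rfl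

/-- The sections of `A = M ×_H (𝔩/𝔥)` over `M/H`: the smooth maps `a : M → 𝔩/𝔥` with
`a(m h) = Ad_{h⁻¹} a(m)`. -/
def quotSections (_S : LHSpace P EM M) : Submodule ℝ (M → 𝔩 ⧸ 𝔥.toSubmodule) where
  carrier := {a | SmoothInto EM a ∧ ∀ (m : M) (h : H), a (op h • m) = P.quotAd h⁻¹ (a m)}
  add_mem' := fun ha hb => ⟨ha.1.add hb.1, fun m h => by simp [ha.2, hb.2]⟩
  zero_mem' := ⟨.const 0, fun m h => by simp⟩
  smul_mem' := fun t a ha => ⟨.smul contMDiff_const ha.1, fun m h => by simp [ha.2]⟩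

theorem act_smooth (S : LHSpace P EM M) (h : H) : ContMDiff 𝓘(ℝ, EM) 𝓘(ℝ, EM) ∞ (fun m : M => op h • m) :=
  S.smooth_act.comp (contMDiff_id.prodMk contMDiff_const)

theorem orbit_smooth (S : LHSpace P EM M) (m : M) : ContMDiff 𝓘(ℝ, EH) 𝓘(ℝ, EM) ∞ (fun h : H => op h • m) :=
  S.smooth_act.comp (contMDiff_const.prodMk contMDiff_id)

theorem mvfderiv_infinitesimal {f : M → ℝ} (hf : ContMDiff 𝓘(ℝ, EM) 𝓘(ℝ, ℝ) ∞ f) (m : M)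
    (v : GroupLieAlgebra 𝓘(ℝ, EH) H) :
    mvfderiv 𝓘(ℝ, EM) f m (S.lam (P.ι v) m) =
      mvfderiv 𝓘(ℝ, EH) (fun h : H => f (op h • m)) 1 v := by
  rw [S.lam_infinitesimal]
  exact (mvfderiv_comp_apply_of_eq (I := 𝓘(ℝ, EM)) (1 : H) (hf.mdifferentiable (by simp) m)
    ((S.orbit_smooth m).mdifferentiable (by simp) 1) (by simp) v).symm

theorem mvfderiv_act {f : M → ℝ} (hf : ContMDiff 𝓘(ℝ, EM) 𝓘(ℝ, ℝ) ∞ f) (m : M) (h : H) (x : 𝔩) :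
    mvfderiv 𝓘(ℝ, EM) f (op h • m) (S.lam x (op h • m)) =
      mvfderiv 𝓘(ℝ, EM) (fun m' : M => f (op h • m')) m (S.lam (P.Ad h x) m) := by
  rw [S.lam_equivariant]
  exact (mvfderiv_comp_apply (I := 𝓘(ℝ, EM)) m (hf.mdifferentiable (by simp) _)
    ((S.act_smooth h).mdifferentiable (by simp) m) _).symm

theorem dirDeriv_infinitesimal {a : M → 𝔩 ⧸ 𝔥.toSubmodule} (ha : a ∈ S.quotSections) (m : M)
    {u x : 𝔩} (hu : u ∈ 𝔥) (hx : 𝔥.toSubmodule.mkQ x = a m) :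
    dirDeriv a m (S.lam u m) = -𝔥.toSubmodule.mkQ ⁅u, x⁆ := by
  obtain ⟨v, hv⟩ := P.ι.surjective ⟨u, hu⟩
  have hu' : u = P.ι v := by rw [hv]
  rw [hu']
  refine dirDeriv_eq_of_dual ha.1 fun φ => ?_
  rw [S.mvfderiv_infinitesimal (ha.1 φ)]
  simp only [ha.2, ← hx, P.quotAd_mk]
  rw [map_neg]
  exact (P.Ad_inv_deriv v x (φ ∘ₗ 𝔥.toSubmodule.mkQ)).2

theorem dirDeriv_equivariant {a : M → 𝔩 ⧸ 𝔥.toSubmodule} (ha : a ∈ S.quotSections) (m : M)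
    (h : H) (x : 𝔩) :
    dirDeriv a (op h • m) (S.lam x (op h • m)) =
      P.quotAd h⁻¹ (dirDeriv a m (S.lam (P.Ad h x) m)) := by
  refine dirDeriv_eq_of_dual ha.1 fun φ => ?_
  rw [S.mvfderiv_act (ha.1 φ), ← dirDeriv_linear ha.1]
  simp only [ha.2]
  exact (dual_dirDeriv (ha.1.linear _) φ _ _).symm

theorem bracket_aux {a b : M → 𝔩 ⧸ 𝔥.toSubmodule} (ha : a ∈ S.quotSections)
    (hb : b ∈ S.quotSections) (m : M) {x x' y y' : 𝔩}
    (hx : 𝔥.toSubmodule.mkQ x = a m) (hx' : 𝔥.toSubmodule.mkQ x' = a m)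
    (hy : 𝔥.toSubmodule.mkQ y = b m) (hy' : 𝔥.toSubmodule.mkQ y' = b m) :
    𝔥.toSubmodule.mkQ ⁅x, y⁆ + dirDeriv b m (S.lam x m) - dirDeriv a m (S.lam y m) =
      𝔥.toSubmodule.mkQ ⁅x', y'⁆ + dirDeriv b m (S.lam x' m) - dirDeriv a m (S.lam y' m) := by
  obtain ⟨u, rfl⟩ : ∃ u, x = x' + u := ⟨x - x', by simp⟩
  obtain ⟨w, rfl⟩ : ∃ w, y = y' + w := ⟨y - y', by simp⟩
  have hxu : u ∈ 𝔥 := by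
    rw [map_add, hx', add_eq_left] at hx
    exact (Submodule.Quotient.mk_eq_zero _).1 hx
  have hyw : w ∈ 𝔥 := by
    rw [map_add, hy', add_eq_left] at hy
    exact (Submodule.Quotient.mk_eq_zero _).1 hy
  have h1 := S.dirDeriv_infinitesimal hb m hxu hy
  have h2 := S.dirDeriv_infinitesimal ha m hyw hx'
  rw [map_add S.lam, map_add S.lam, Pi.add_apply, Pi.add_apply, dirDeriv_add_vec,
    dirDeriv_add_vec, h1, h2, add_lie x' u (y' + w), lie_add x' y' w, map_add, map_add,
    ← lie_skew w x', map_neg]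
  abel

/-- The projection to `A` of a section of `M ⋊_λ 𝔩`. -/
theorem mk_transBracket {a b : M → 𝔩 ⧸ 𝔥.toSubmodule} {a' b' : M → 𝔩} (ha' : SmoothInto EM a')
    (hb' : SmoothInto EM b') (haa : ∀ m, 𝔥.toSubmodule.mkQ (a' m) = a m)
    (hbb : ∀ m, 𝔥.toSubmodule.mkQ (b' m) = b m) (m : M) :
    𝔥.toSubmodule.mkQ (S.transBracket a' b' m) = 𝔥.toSubmodule.mkQ ⁅a' m, b' m⁆ +
      dirDeriv b m (S.lam (a' m) m) - dirDeriv a m (S.lam (b' m) m) := by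
  obtain rfl : (fun m => 𝔥.toSubmodule.mkQ (a' m)) = a := funext haa
  obtain rfl : (fun m => 𝔥.toSubmodule.mkQ (b' m)) = b := funext hbb
  rw [dirDeriv_linear ha', dirDeriv_linear hb', transBracket, map_sub, map_add]
  rfl

variable (𝔥) in
/-- A linear section of `𝔩 → 𝔩/𝔥`. -/
def quotLift : (𝔩 ⧸ 𝔥.toSubmodule) →ₗ[ℝ] 𝔩 :=
  Classical.choose (𝔥.toSubmodule.mkQ.exists_rightInverse_of_surjective (Submodule.range_mkQ _))

theorem mk_quotLift (x : 𝔩 ⧸ 𝔥.toSubmodule) : 𝔥.toSubmodule.mkQ (quotLift 𝔥 x) = x :=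
  LinearMap.congr_fun (Classical.choose_spec
    (𝔥.toSubmodule.mkQ.exists_rightInverse_of_surjective (Submodule.range_mkQ _))) x

theorem quotSections_lift {a : M → 𝔩 ⧸ 𝔥.toSubmodule} (ha : a ∈ S.quotSections) :
    SmoothInto EM (fun m => quotLift 𝔥 (a m)) := ha.1.linear _

/-- The bracket `[a, b] = 𝔭([ã, b̃])` on `Γ(A)`, where `ã, b̃ : M → 𝔩` are smooth lifts of `a, b`;
it is independent of the lifts, see `quotBracket_eq`. -/
def quotBracket (a b : M → 𝔩 ⧸ 𝔥.toSubmodule) (m : M) : 𝔩 ⧸ 𝔥.toSubmodule :=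
  𝔥.toSubmodule.mkQ
    (S.transBracket (fun m => quotLift 𝔥 (a m)) (fun m => quotLift 𝔥 (b m)) m)

theorem quotBracket_apply {a b : M → 𝔩 ⧸ 𝔥.toSubmodule} (ha : a ∈ S.quotSections)
    (hb : b ∈ S.quotSections) (m : M) {x y : 𝔩} (hx : 𝔥.toSubmodule.mkQ x = a m)
    (hy : 𝔥.toSubmodule.mkQ y = b m) :
    S.quotBracket a b m =
      𝔥.toSubmodule.mkQ ⁅x, y⁆ + dirDeriv b m (S.lam x m) - dirDeriv a m (S.lam y m) :=
  (S.mk_transBracket (S.quotSections_lift ha) (S.quotSections_lift hb) (fun _ => mk_quotLift _)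
    (fun _ => mk_quotLift _) m).trans
    (S.bracket_aux ha hb m (mk_quotLift _) hx (mk_quotLift _) hy)

/-- The bracket of `Γ(A)` can be computed with arbitrary smooth lifts. -/
theorem quotBracket_eq {a b : M → 𝔩 ⧸ 𝔥.toSubmodule} (ha : a ∈ S.quotSections)
    (hb : b ∈ S.quotSections) {a' b' : M → 𝔩} (ha' : SmoothInto EM a') (hb' : SmoothInto EM b')
    (haa : ∀ m, 𝔥.toSubmodule.mkQ (a' m) = a m) (hbb : ∀ m, 𝔥.toSubmodule.mkQ (b' m) = b m) (m : M) :
    S.quotBracket a b m = 𝔥.toSubmodule.mkQ (S.transBracket a' b' m) :=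
  (S.quotBracket_apply ha hb m (haa m) (hbb m)).trans
    (S.mk_transBracket ha' hb' haa hbb m).symm

theorem mk_Ad_of_quotSections {a : M → 𝔩 ⧸ 𝔥.toSubmodule} (ha : a ∈ S.quotSections) (m : M) (h : H)
    {x : 𝔩} (hx : 𝔥.toSubmodule.mkQ x = a (op h • m)) : 𝔥.toSubmodule.mkQ (P.Ad h x) = a m := by
  have hc : ∀ y : 𝔩, P.Ad h (P.Ad h⁻¹ y) = y := fun y => by
    rw [← Module.End.mul_apply, ← map_mul, mul_inv_cancel, map_one, Module.End.one_apply]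
  rw [ha.2, ← mk_quotLift (a m), P.quotAd_mk] at hx
  rw [← P.quotAd_mk, hx, P.quotAd_mk, hc, mk_quotLift]

theorem quotBracket_mem {a b : M → 𝔩 ⧸ 𝔥.toSubmodule} (ha : a ∈ S.quotSections)
    (hb : b ∈ S.quotSections) : S.quotBracket a b ∈ S.quotSections := by
  refine ⟨(S.smooth_transBracket (S.quotSections_lift ha) (S.quotSections_lift hb)).linear _,
    fun m h => ?_⟩
  have hc : ∀ y : 𝔩, P.Ad h⁻¹ (P.Ad h y) = y := fun y => by
    rw [← Module.End.mul_apply, ← map_mul, inv_mul_cancel, map_one, Module.End.one_apply]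
  have hx := mk_quotLift (a (op h • m))
  have hy := mk_quotLift (b (op h • m))
  rw [S.quotBracket_apply ha hb _ hx hy, S.quotBracket_apply ha hb m
    (S.mk_Ad_of_quotSections ha m h hx) (S.mk_Ad_of_quotSections hb m h hy),
    S.dirDeriv_equivariant ha, S.dirDeriv_equivariant hb, map_sub, map_add, P.quotAd_mk,
    P.Ad_lie, hc, hc]

theorem lift_quotBracket {a b c : M → 𝔩 ⧸ 𝔥.toSubmodule} (ha : a ∈ S.quotSections)
    (hb : b ∈ S.quotSections) (hc : c ∈ S.quotSections) (m : M) :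
    S.quotBracket a (S.quotBracket b c) m = 𝔥.toSubmodule.mkQ (S.transBracket
      (fun m => quotLift 𝔥 (a m))
      (S.transBracket (fun m => quotLift 𝔥 (b m)) (fun m => quotLift 𝔥 (c m))) m) ∧
    S.quotBracket (S.quotBracket a b) c m = 𝔥.toSubmodule.mkQ (S.transBracket
      (S.transBracket (fun m => quotLift 𝔥 (a m)) (fun m => quotLift 𝔥 (b m)))
      (fun m => quotLift 𝔥 (c m)) m) :=
  ⟨S.quotBracket_eq ha (S.quotBracket_mem hb hc) (S.quotSections_lift ha)
    (S.smooth_transBracket (S.quotSections_lift hb) (S.quotSections_lift hc))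
    (fun _ => mk_quotLift _) (fun _ => rfl) m,
   S.quotBracket_eq (S.quotBracket_mem ha hb) hc (S.smooth_transBracket (S.quotSections_lift ha)
    (S.quotSections_lift hb)) (S.quotSections_lift hc) (fun _ => rfl)
    (fun _ => mk_quotLift _) m⟩

theorem quotBracket_add_left {a a' b : M → 𝔩 ⧸ 𝔥.toSubmodule} (ha : a ∈ S.quotSections)
    (ha' : a' ∈ S.quotSections) (hb : b ∈ S.quotSections) :
    S.quotBracket (a + a') b = S.quotBracket a b + S.quotBracket a' b := by
  ext1 m
  have hy := mk_quotLift (b m)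
  have hx := mk_quotLift (a m)
  have hx' := mk_quotLift (a' m)
  rw [Pi.add_apply, S.quotBracket_apply ha hb m hx hy, S.quotBracket_apply ha' hb m hx' hy,
    S.quotBracket_apply (S.quotSections.add_mem ha ha') hb m
      (x := quotLift 𝔥 (a m) + quotLift 𝔥 (a' m)) (by rw [map_add, hx, hx', Pi.add_apply]) hy,
    add_lie, map_add, map_add, Pi.add_apply, dirDeriv_add_vec]
  have := dirDeriv_add ha.1 ha'.1 m (S.lam (quotLift 𝔥 (b m)) m)
  rw [show a + a' = fun m => a m + a' m from rfl, this]
  abel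

theorem quotBracket_swap (a b : M → 𝔩 ⧸ 𝔥.toSubmodule) :
    S.quotBracket a b = - S.quotBracket b a := by
  ext1 m
  simp only [quotBracket, Pi.neg_apply, ← map_neg]
  congr 1
  simp only [transBracket]
  rw [← lie_skew]
  abel

theorem quotBracket_smul_right {a b : M → 𝔩 ⧸ 𝔥.toSubmodule} (ha : a ∈ S.quotSections)
    (hb : b ∈ S.quotSections) {f : M → ℝ} (hf : ContMDiff 𝓘(ℝ, EM) 𝓘(ℝ, ℝ) ∞ f)
    (hfb : (fun m => f m • b m) ∈ S.quotSections) (m : M) :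
    S.quotBracket a (fun m => f m • b m) m = f m • S.quotBracket a b m +
      mvfderiv 𝓘(ℝ, EM) f m (S.lam (quotLift 𝔥 (a m)) m) • b m := by
  have hy := mk_quotLift (b m)
  have hx := mk_quotLift (a m)
  rw [S.quotBracket_apply ha hb m hx hy, S.quotBracket_apply ha hfb m (y := f m • quotLift 𝔥 (b m)) hx
    (by rw [map_smul, hy]), dirDeriv_smul hf hb.1, lie_smul, map_smul, map_smul, Pi.smul_apply,
    dirDeriv_smul_vec]
  module

instance : Bracket S.quotSections S.quotSections :=
  ⟨fun a b => ⟨S.quotBracket a b, S.quotBracket_mem a.2 b.2⟩⟩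

/-- `Γ(A)` is a Lie algebra. -/
instance : LieRing S.quotSections where
  add_lie a b c := Subtype.ext (S.quotBracket_add_left a.2 b.2 c.2)
  lie_add a b c := Subtype.ext <| by
    have h := S.quotBracket_add_left b.2 c.2 a.2
    change S.quotBracket a.1 (b.1 + c.1) = S.quotBracket a.1 b.1 + S.quotBracket a.1 c.1
    rw [S.quotBracket_swap, h, neg_add, ← S.quotBracket_swap, ← S.quotBracket_swap]
  lie_self a := Subtype.ext <| by
    ext1 m
    change S.quotBracket a.1 a.1 m = 0
    simp [quotBracket, transBracket]
  leibniz_lie a b c := Subtype.ext <| by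
    ext1 m
    change S.quotBracket a.1 (S.quotBracket b.1 c.1) m =
      S.quotBracket (S.quotBracket a.1 b.1) c.1 m + S.quotBracket b.1 (S.quotBracket a.1 c.1) m
    rw [(S.lift_quotBracket a.2 b.2 c.2 m).1, (S.lift_quotBracket a.2 b.2 c.2 m).2,
      (S.lift_quotBracket b.2 a.2 c.2 m).1, ← map_add]
    exact congrArg _ (S.transBracket_jacobi (S.quotSections_lift a.2) (S.quotSections_lift b.2)
      (S.quotSections_lift c.2) m)

instance : LieAlgebra ℝ S.quotSections where
  lie_smul t a b := Subtype.ext <| by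
    ext1 m
    have := S.quotBracket_smul_right a.2 b.2 (f := fun _ => t) contMDiff_const
      (S.quotSections.smul_mem t b.2) m
    rw [mvfderiv_const, zero_apply, zero_smul, add_zero] at this
    exact this

variable (EM H M) in
/-- `C^∞(M/H)`: the functions on the orbit space whose pullback to `M` is smooth. -/
def orbitSmooth : Subalgebra ℝ (MulAction.orbitRel.Quotient Hᵐᵒᵖ M → ℝ) where
  carrier := {f | ContMDiff 𝓘(ℝ, EM) 𝓘(ℝ, ℝ) ∞
    (fun m : M => f (Quotient.mk (MulAction.orbitRel Hᵐᵒᵖ M) m))}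
  mul_mem' := fun hf hg => hf.mul hg
  add_mem' := fun hf hg => hf.add hg
  algebraMap_mem' := fun _ => contMDiff_const

/-- The pullback of a smooth function on `M/H` to `M`. -/
def pull (f : orbitSmooth H EM M) (m : M) : ℝ := f.1 (Quotient.mk (MulAction.orbitRel Hᵐᵒᵖ M) m)

theorem pull_smooth (f : orbitSmooth H EM M) : ContMDiff 𝓘(ℝ, EM) 𝓘(ℝ, ℝ) ∞ (pull f) := f.2

theorem pull_act (f : orbitSmooth H EM M) (m : M) (h : H) : pull f (op h • m) = pull f m :=
  congrArg f.1 (Quotient.sound (s := MulAction.orbitRel Hᵐᵒᵖ M) ⟨op h, rfl⟩)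

theorem pull_ext {f g : orbitSmooth H EM M} (h : ∀ m, pull f m = pull g m) : f = g :=
  Subtype.ext <| funext fun q => Quotient.inductionOn q h

/-- A smooth invariant function on `M` as a smooth function on `M/H`. -/
def descend (f : M → ℝ) (hf : ContMDiff 𝓘(ℝ, EM) 𝓘(ℝ, ℝ) ∞ f)
    (hi : ∀ (m : M) (h : H), f (op h • m) = f m) : orbitSmooth H EM M :=
  ⟨Quotient.lift f (by rintro _ m ⟨h, rfl⟩; exact hi m h.unop), hf⟩

instance : Module (orbitSmooth H EM M) S.quotSections where
  smul f a := ⟨fun m => pull f m • a.1 m, .smul (pull_smooth f) a.2.1, fun m h => by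
    simp only [pull_act, a.2.2, map_smul]⟩
  one_smul a := Subtype.ext <| funext fun m => one_smul ℝ (a.1 m)
  mul_smul f g a := Subtype.ext <| funext fun m => mul_smul (pull f m) (pull g m) (a.1 m)
  smul_zero f := Subtype.ext <| funext fun m => smul_zero (pull f m)
  smul_add f a b := Subtype.ext <| funext fun m => smul_add (pull f m) (a.1 m) (b.1 m)
  add_smul f g a := Subtype.ext <| funext fun m => add_smul (pull f m) (pull g m) (a.1 m)
  zero_smul a := Subtype.ext <| funext fun m => zero_smul ℝ (a.1 m)

/-- The derivative of the pullback of a function on `M/H` along a lift depends only on the class of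
the lift in `𝔩/𝔥`. -/
theorem mvfderiv_pull (f : orbitSmooth H EM M) (m : M) {x y : 𝔩}
    (hxy : 𝔥.toSubmodule.mkQ x = 𝔥.toSubmodule.mkQ y) :
    mvfderiv 𝓘(ℝ, EM) (pull f) m (S.lam x m) = mvfderiv 𝓘(ℝ, EM) (pull f) m (S.lam y m) := by
  obtain ⟨v, hv⟩ := P.ι.surjective ⟨x - y, (Submodule.Quotient.eq 𝔥.toSubmodule).1 hxy⟩
  have hu : x - y = P.ι v := by rw [hv]
  rw [← sub_eq_zero, ← map_sub, ← Pi.sub_apply, ← map_sub, hu,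
    S.mvfderiv_infinitesimal (pull_smooth f)]
  simp only [pull_act, mvfderiv_const, zero_apply]

/-- The anchor of `A`: `[m, x + 𝔥] ↦ q_* λ_x(m)`, acting on functions on `M/H`. -/
def quotAnchor (a : S.quotSections) (f : orbitSmooth H EM M) : orbitSmooth H EM M :=
  descend (fun m => mvfderiv 𝓘(ℝ, EM) (pull f) m (S.lam (quotLift 𝔥 (a.1 m)) m))
    (S.smooth_anchor_fun (S.quotSections_lift a.2) (pull_smooth f)) fun m h => by
      rw [S.mvfderiv_act (pull_smooth f)]
      simp only [pull_act]
      exact S.mvfderiv_pull f m ((S.mk_Ad_of_quotSections a.2 m h (mk_quotLift _)).trans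
        (mk_quotLift _).symm)

theorem pull_quotAnchor (a : S.quotSections) (f : orbitSmooth H EM M) (m : M) {x : 𝔩}
    (hx : 𝔥.toSubmodule.mkQ x = a.1 m) :
    pull (S.quotAnchor a f) m = mvfderiv 𝓘(ℝ, EM) (pull f) m (S.lam x m) :=
  S.mvfderiv_pull f m ((mk_quotLift _).trans hx.symm)

theorem pull_mdiff (f : orbitSmooth H EM M) (m : M) :
    MDifferentiableAt 𝓘(ℝ, EM) 𝓘(ℝ, ℝ) (pull f) m :=
  (pull_smooth f).mdifferentiable (by simp) m

instance : LieRingModule S.quotSections (orbitSmooth H EM M) where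
  bracket a f := S.quotAnchor a f
  add_lie a b f := pull_ext fun m => by
    have hx := mk_quotLift (a.1 m)
    have hy := mk_quotLift (b.1 m)
    change _ = pull (S.quotAnchor a f) m + pull (S.quotAnchor b f) m
    rw [S.pull_quotAnchor a f m hx, S.pull_quotAnchor b f m hy, S.pull_quotAnchor (a + b) f m
      (x := quotLift 𝔥 (a.1 m) + quotLift 𝔥 (b.1 m)) (by rw [map_add, hx, hy]; rfl), map_add,
      Pi.add_apply, map_add]
  lie_add a f g := pull_ext fun m =>
    congrArg (· (S.lam (quotLift 𝔥 (a.1 m)) m)) (mvfderiv_add (pull_mdiff f m) (pull_mdiff g m))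
  leibniz_lie a b f := pull_ext fun m => by
    have ha := S.quotSections_lift a.2
    have hb := S.quotSections_lift b.2
    change pull (S.quotAnchor a (S.quotAnchor b f)) m =
      pull (S.quotAnchor ⁅a, b⁆ f) m + pull (S.quotAnchor b (S.quotAnchor a f)) m
    rw [S.pull_quotAnchor ⁅a, b⁆ f m (x := S.transBracket (fun m => quotLift 𝔥 (a.1 m))
      (fun m => quotLift 𝔥 (b.1 m)) m) rfl, S.anchor_transBracket_fun ha hb (pull_smooth f)]
    exact (sub_add_cancel _ _).symm

instance : LieRinehartRing (orbitSmooth H EM M) S.quotSections where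
  lie_smul_eq_mul' f g a := pull_ext fun m => by
    have hx := mk_quotLift (a.1 m)
    change pull (S.quotAnchor (f • a) g) m = pull f m * pull (S.quotAnchor a g) m
    rw [S.pull_quotAnchor a g m hx, S.pull_quotAnchor (f • a) g m
      (x := pull f m • quotLift 𝔥 (a.1 m)) (by rw [map_smul, hx]; rfl), map_smul, Pi.smul_apply,
      map_smul, smul_eq_mul]
  leibniz_mul_right' a f g := pull_ext fun m => by
    have := congrArg (· (S.lam (quotLift 𝔥 (a.1 m)) m))
      (mvfderiv_mul (pull_mdiff f m) (pull_mdiff g m))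
    simp only [add_apply, smul_apply, smul_eq_mul] at this
    rw [mul_comm (pull g m)] at this
    exact this
  leibniz_smul_right' a b f := Subtype.ext <| funext fun m =>
    S.quotBracket_smul_right a.2 b.2 (pull_smooth f) (f • b).2 m

/-- `A` is a Lie algebroid over `M/H`. -/
instance : LieRinehartAlgebra ℝ (orbitSmooth H EM M) S.quotSections where
  smul_assoc t f a := Subtype.ext <| funext fun m => smul_assoc t (pull f m) (a.1 m)
  smul_lie t a f := pull_ext fun m => by
    have hx := mk_quotLift (a.1 m)
    change pull (S.quotAnchor (t • a) f) m = t • pull (S.quotAnchor a f) m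
    rw [S.pull_quotAnchor a f m hx, S.pull_quotAnchor (t • a) f m
      (x := t • quotLift 𝔥 (a.1 m)) (by rw [map_smul, hx]; rfl), map_smul, Pi.smul_apply,
      map_smul]
  lie_smul t a f := pull_ext fun m => by
    have := congrArg (· (S.lam (quotLift 𝔥 (a.1 m)) m))
      (mvfderiv_mul (mdifferentiableAt_const (c := t)) (pull_mdiff f m))
    simp only [add_apply, smul_apply, smul_eq_mul, mvfderiv_const, zero_apply, mul_zero,
      add_zero] at this
    exact this

end LHSpace

end Setting

section Bundle

variable {𝔩 : Type*} [LieRing 𝔩] [LieAlgebra ℝ 𝔩] {𝔥 : LieSubalgebra ℝ 𝔩} {EH H : Type*}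
  [NormedAddCommGroup EH] [NormedSpace ℝ EH] [TopologicalSpace H] [ChartedSpace EH H] [Group H]
  {EM M : Type*} [NormedAddCommGroup EM] [NormedSpace ℝ EM] [TopologicalSpace M]
  [ChartedSpace EM M] [IsManifold 𝓘(ℝ, EM) ∞ M] [MulAction Hᵐᵒᵖ M]
  {F : Type*} [NormedAddCommGroup F] [NormedSpace ℝ F]
  {E : M → Type*} [TopologicalSpace (TotalSpace F E)] [∀ m, TopologicalSpace (E m)]
  [FiberBundle F E] [∀ m, AddCommGroup (E m)] [∀ m, Module ℝ (E m)] [VectorBundle ℝ F E]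

variable (EH H EM F E) in
/-- An `H`-equivariant structure on a smooth vector bundle `E → M`: a smooth right action of `H` on
the total space, over the action on `M` and linear on the fibres. -/
structure EquivariantBundle where
  /-- the map `E_m → E_{m h}` given by `h` -/
  T : ∀ (h : H) (m : M), E m ≃ₗ[ℝ] E (op h • m)
  T_one : ∀ (m : M) (e : E m), (⟨op (1 : H) • m, T 1 m e⟩ : TotalSpace F E) = ⟨m, e⟩
  T_mul : ∀ (h h' : H) (m : M) (e : E m), (⟨op (h * h') • m, T (h * h') m e⟩ : TotalSpace F E) =
    ⟨op h' • op h • m, T h' (op h • m) (T h m e)⟩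
  T_smooth : ContMDiff ((𝓘(ℝ, EM).prod 𝓘(ℝ, F)).prod 𝓘(ℝ, EH)) (𝓘(ℝ, EM).prod 𝓘(ℝ, F)) ∞
    (fun p : TotalSpace F E × H => (⟨op p.2 • p.1.1, T p.2 p.1.1 p.1.2⟩ : TotalSpace F E))

namespace EquivariantBundle

theorem T_inv (B : EquivariantBundle EH H EM F E) (h : H) (m : M) (e : E (op h • m)) :
    (⟨op h⁻¹ • op h • m, B.T h⁻¹ (op h • m) e⟩ : TotalSpace F E) = ⟨m, (B.T h m).symm e⟩ := by
  have h1 := B.T_mul h h⁻¹ m ((B.T h m).symm e)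
  rw [LinearEquiv.apply_symm_apply] at h1
  rw [← h1, mul_inv_cancel, B.T_one]

/-- The action of `H` on `Γ(E)`: `(h s)(m) = s(m h) h⁻¹`. -/
def secAct (B : EquivariantBundle EH H EM F E) (P : LieGroupPair 𝔥 EH H) (S : LHSpace P EM M) :
    Representation ℝ H Cₛ^∞⟮𝓘(ℝ, EM); F, E⟯ where
  toFun h :=
    { toFun := fun s => ⟨fun m => (B.T h m).symm (s (op h • m)), by
        have h1 : ContMDiff 𝓘(ℝ, EM) 𝓘(ℝ, EM) ∞ (fun m : M => op h • m) :=
          S.smooth_act.comp (contMDiff_id.prodMk contMDiff_const)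
        have h2 := B.T_smooth.comp ((s.contMDiff.comp h1).prodMk
          (contMDiff_const (c := h⁻¹) (I' := 𝓘(ℝ, EH))))
        refine h2.congr fun m => ?_
        exact (B.T_inv h m (s (op h • m))).symm⟩
      map_add' := fun s t => by ext m; simp
      map_smul' := fun c s => by ext m; simp }
  map_one' := by
    ext s m
    refine (LinearEquiv.symm_apply_eq _).2 ?_
    have h1 := B.T_one m (s m)
    have h2 : (⟨op (1 : H) • m, s (op (1 : H) • m)⟩ : TotalSpace F E) = ⟨m, s m⟩ := by
      rw [op_one, one_smul]
    exact eq_of_heq (TotalSpace.mk.inj (h2.trans h1.symm)).2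
  map_mul' h h' := by
    ext s m
    refine (LinearEquiv.symm_apply_eq _).2 ?_
    have h1 := B.T_mul h h' m ((B.T h m).symm ((B.T h' (op h • m)).symm (s (op h' • op h • m))))
    rw [LinearEquiv.apply_symm_apply, LinearEquiv.apply_symm_apply] at h1
    have h2 : (⟨op (h * h') • m, s (op (h * h') • m)⟩ : TotalSpace F E) =
        ⟨op h' • op h • m, s (op h' • op h • m)⟩ := by
      rw [op_mul, mul_smul]
    exact eq_of_heq (TotalSpace.mk.inj (h2.trans h1.symm)).2

end EquivariantBundle

/-- The product of a smooth function and a smooth section. -/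
def secSMul (f : M → ℝ) (hf : ContMDiff 𝓘(ℝ, EM) 𝓘(ℝ, ℝ) ∞ f) (s : Cₛ^∞⟮𝓘(ℝ, EM); F, E⟯) :
    Cₛ^∞⟮𝓘(ℝ, EM); F, E⟯ :=
  ⟨fun m => f m • s m, hf.smul_section s.contMDiff⟩

variable (F E) in
/-- An `(𝔩, H)`-vector bundle: an `H`-equivariant vector bundle with a representation of `𝔩` on
`Γ(E)` that satisfies the Leibniz rule and makes `Γ(E)` an `(𝔩, H)`-module. The smoothness of
`h ↦ h s` is automatic, as the action of `H` on `E` is smooth; the derivatives of these maps are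
computed pointwise, in coordinates of the fibre. -/
structure LHBundle {P : LieGroupPair 𝔥 EH H} (S : LHSpace P EM M)
    [LieRingModule 𝔩 Cₛ^∞⟮𝓘(ℝ, EM); F, E⟯] [LieModule ℝ 𝔩 Cₛ^∞⟮𝓘(ℝ, EM); F, E⟯] extends
    EquivariantBundle EH H EM F E where
  leibniz : ∀ (x : 𝔩) (f : M → ℝ) (hf : ContMDiff 𝓘(ℝ, EM) 𝓘(ℝ, ℝ) ∞ f)
    (s : Cₛ^∞⟮𝓘(ℝ, EM); F, E⟯) (m : M),
    (⁅x, secSMul f hf s⁆ : Cₛ^∞⟮𝓘(ℝ, EM); F, E⟯) m =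
      mvfderiv 𝓘(ℝ, EM) f m (S.lam x m) • s m + f m • (⁅x, s⁆ : Cₛ^∞⟮𝓘(ℝ, EM); F, E⟯) m
  /-- the action of `𝔥` is the derivative of the action of `H` -/
  infinitesimal : ∀ (v : GroupLieAlgebra 𝓘(ℝ, EH) H) (s : Cₛ^∞⟮𝓘(ℝ, EM); F, E⟯) (m : M)
    (φ : Module.Dual ℝ (E m)),
    mvfderiv 𝓘(ℝ, EH) (fun h : H => φ (toEquivariantBundle.secAct P S h s m)) 1 v =
      φ ((⁅(P.ι v : 𝔩), s⁆ : Cₛ^∞⟮𝓘(ℝ, EM); F, E⟯) m)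
  /-- `h (x (h⁻¹ s)) = (Ad_h x) s` -/
  equivariant : ∀ (h : H) (x : 𝔩) (s : Cₛ^∞⟮𝓘(ℝ, EM); F, E⟯),
    toEquivariantBundle.secAct P S h ⁅x, toEquivariantBundle.secAct P S h⁻¹ s⁆ = ⁅P.Ad h x, s⁆

namespace LHBundle

variable [FiniteDimensional ℝ 𝔩] [LieGroup 𝓘(ℝ, EH) ∞ H] [FiniteDimensional ℝ EM]
  {P : LieGroupPair 𝔥 EH H} {S : LHSpace P EM M}
  [LieRingModule 𝔩 Cₛ^∞⟮𝓘(ℝ, EM); F, E⟯] [LieModule ℝ 𝔩 Cₛ^∞⟮𝓘(ℝ, EM); F, E⟯]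
  (B : LHBundle F E S)

/-- The representation of `H` on `Γ(E)`. -/
def ρ : Representation ℝ H Cₛ^∞⟮𝓘(ℝ, EM); F, E⟯ := B.toEquivariantBundle.secAct P S

/-- `Γ(E/H) = Γ(E)^H`, the `H`-invariant smooth sections of `E`. -/
def invSections : Submodule ℝ Cₛ^∞⟮𝓘(ℝ, EM); F, E⟯ where
  carrier := {s | ∀ h, B.ρ h s = s}
  add_mem' := fun hs ht h => by rw [map_add, hs h, ht h]
  zero_mem' := fun h => map_zero _
  smul_mem' := fun c s hs h => by rw [map_smul, hs h]

theorem ρ_apply (h : H) (s : Cₛ^∞⟮𝓘(ℝ, EM); F, E⟯) (m : M) :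
    B.ρ h s m = (B.T h m).symm (s (op h • m)) := rfl

variable (F) in
/-- evaluation of a section at a point -/
def evalAt (m : M) : Cₛ^∞⟮𝓘(ℝ, EM); F, E⟯ →ₗ[ℝ] E m where
  toFun s := s m
  map_add' _ _ := rfl
  map_smul' _ _ := rfl

variable (F) in
/-- `(x, s) ↦ (x · s)(m)`, as a linear map of `x`. -/
def actAt
    (s : Cₛ^∞⟮𝓘(ℝ, EM); F, E⟯) (m : M) : 𝔩 →ₗ[ℝ] E m where
  toFun x := (⁅x, s⁆ : Cₛ^∞⟮𝓘(ℝ, EM); F, E⟯) m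
  map_add' x y := by rw [add_lie]; rfl
  map_smul' c x := by rw [smul_lie]; rfl

theorem smooth_act_along {b : M → 𝔩} (hb : SmoothInto EM b)
    (s : Cₛ^∞⟮𝓘(ℝ, EM); F, E⟯) :
    ContMDiff 𝓘(ℝ, EM) (𝓘(ℝ, EM).prod 𝓘(ℝ, F)) ∞ (fun m => (⟨m,
      (⁅b m, s⁆ : Cₛ^∞⟮𝓘(ℝ, EM); F, E⟯) m⟩ : TotalSpace F E)) := by
  have : (fun m => (⁅b m, s⁆ : Cₛ^∞⟮𝓘(ℝ, EM); F, E⟯) m) = fun m =>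
      ∑ i, (secSMul (fun m => (Module.finBasis ℝ 𝔩).coord i (b m)) (hb _)
        (⁅Module.finBasis ℝ 𝔩 i, s⁆ : Cₛ^∞⟮𝓘(ℝ, EM); F, E⟯)) m := by
    ext m
    exact sum_coord_smul (actAt F s m) (b m)
  rw [show (fun m => (⟨m, (⁅b m, s⁆ : Cₛ^∞⟮𝓘(ℝ, EM); F, E⟯) m⟩ : TotalSpace F E)) =
    fun m => (⟨m, (fun m => (⁅b m, s⁆ : Cₛ^∞⟮𝓘(ℝ, EM); F, E⟯) m) m⟩ : TotalSpace F E) from rfl, this]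
  exact ContMDiff.sum_section fun i _ => ContMDiffSection.contMDiff _

/-- The representation of `M ⋊_λ 𝔩` on `E`: `(D̃_b s)(m) = (b(m) · s)(m)`. -/
def transAct (b : M → 𝔩) (hb : SmoothInto EM b)
    (s : Cₛ^∞⟮𝓘(ℝ, EM); F, E⟯) : Cₛ^∞⟮𝓘(ℝ, EM); F, E⟯ :=
  ⟨fun m => (⁅b m, s⁆ : Cₛ^∞⟮𝓘(ℝ, EM); F, E⟯) m, smooth_act_along hb s⟩

theorem act_transAct (B : LHBundle F E S) {b : M → 𝔩} (hb : SmoothInto EM b) (s : Cₛ^∞⟮𝓘(ℝ, EM); F, E⟯) (m : M)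
    (x : 𝔩) : (⁅x, transAct b hb s⁆ : Cₛ^∞⟮𝓘(ℝ, EM); F, E⟯) m =
      (⁅dirDeriv b m (S.lam x m), s⁆ : Cₛ^∞⟮𝓘(ℝ, EM); F, E⟯) m +
      (⁅x, ⁅b m, s⁆⁆ : Cₛ^∞⟮𝓘(ℝ, EM); F, E⟯) m := by
  have h : transAct b hb s = ∑ i, secSMul (fun m => (Module.finBasis ℝ 𝔩).coord i (b m)) (hb _)
        (⁅Module.finBasis ℝ 𝔩 i, s⁆ : Cₛ^∞⟮𝓘(ℝ, EM); F, E⟯) := by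
    ext m
    rw [show (∑ i, secSMul (fun m => (Module.finBasis ℝ 𝔩).coord i (b m)) (hb _)
        (⁅Module.finBasis ℝ 𝔩 i, s⁆ : Cₛ^∞⟮𝓘(ℝ, EM); F, E⟯)) m = ∑ i, (secSMul (fun m =>
          (Module.finBasis ℝ 𝔩).coord i (b m)) (hb _)
        (⁅Module.finBasis ℝ 𝔩 i, s⁆ : Cₛ^∞⟮𝓘(ℝ, EM); F, E⟯)) m from
      map_sum (evalAt F m) _ _]
    exact sum_coord_smul (actAt F s m) (b m)
  have h2 : (⁅b m, s⁆ : Cₛ^∞⟮𝓘(ℝ, EM); F, E⟯) = ∑ i, (Module.finBasis ℝ 𝔩).coord i (b m) •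
      (⁅Module.finBasis ℝ 𝔩 i, s⁆ : Cₛ^∞⟮𝓘(ℝ, EM); F, E⟯) :=
    sum_coord_smul (LinearMap.mk (AddHom.mk (fun x : 𝔩 => (⁅x, s⁆ : Cₛ^∞⟮𝓘(ℝ, EM); F, E⟯))
      fun x y => add_lie x y s) fun c x => smul_lie c x s) (b m)
  rw [h, h2, lie_sum, lie_sum]
  change evalAt F m _ = _ + evalAt F m _
  rw [map_sum, map_sum]
  change ∑ i, (⁅x, secSMul _ _ _⁆ : Cₛ^∞⟮𝓘(ℝ, EM); F, E⟯) m = _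
  simp only [B.leibniz, Finset.sum_add_distrib, lie_smul, map_smul]
  congr 1
  rw [show (⁅dirDeriv b m (S.lam x m), s⁆ : Cₛ^∞⟮𝓘(ℝ, EM); F, E⟯) m =
    actAt F s m (dirDeriv b m (S.lam x m)) from rfl, sum_coord_smul (actAt F s m)]
  refine Finset.sum_congr rfl fun i _ => ?_
  rw [dual_dirDeriv hb]
  rfl

theorem act_of_mem {s : Cₛ^∞⟮𝓘(ℝ, EM); F, E⟯} (hs : s ∈ B.invSections) (m : M) {x y : 𝔩}
    (hxy : 𝔥.toSubmodule.mkQ x = 𝔥.toSubmodule.mkQ y) :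
    (⁅x, s⁆ : Cₛ^∞⟮𝓘(ℝ, EM); F, E⟯) m = (⁅y, s⁆ : Cₛ^∞⟮𝓘(ℝ, EM); F, E⟯) m := by
  obtain ⟨v, hv⟩ := P.ι.surjective ⟨x - y, (Submodule.Quotient.eq 𝔥.toSubmodule).1 hxy⟩
  have hu : x - y = P.ι v := by rw [hv]
  change actAt F s m x = actAt F s m y
  rw [← sub_eq_zero, ← map_sub, hu, ← Module.forall_dual_apply_eq_zero_iff ℝ]
  intro φ
  refine (B.infinitesimal v s m φ).symm.trans ?_
  have : ∀ h, B.secAct P S h s = s := hs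
  simp only [this, mvfderiv_const, zero_apply]

theorem transAct_mem {a : M → 𝔩 ⧸ 𝔥.toSubmodule} (ha : a ∈ S.quotSections)
    {s : Cₛ^∞⟮𝓘(ℝ, EM); F, E⟯} (hs : s ∈ B.invSections) :
    transAct (fun m => LHSpace.quotLift 𝔥 (a m)) (S.quotSections_lift ha) s ∈ B.invSections := by
  intro h
  ext m
  have h1 := B.equivariant h (LHSpace.quotLift 𝔥 (a (op h • m))) s
  have hs' : ∀ h, B.secAct P S h s = s := hs
  rw [hs'] at h1
  have h2 : B.ρ h (transAct (fun m => LHSpace.quotLift 𝔥 (a m)) (S.quotSections_lift ha) s) m =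
    B.secAct P S h ⁅LHSpace.quotLift 𝔥 (a (op h • m)), s⁆ m := rfl
  rw [h2, h1]
  exact B.act_of_mem hs m ((S.mk_Ad_of_quotSections ha m h (LHSpace.mk_quotLift _)).trans
    (LHSpace.mk_quotLift _).symm)

/-- The representation of `A` on `E/H`: `D_a s = D̃_ã s`, where `ã : M → 𝔩` is a smooth lift of
`a`; it is independent of the lift, see `lie_apply`. -/
instance : Bracket S.quotSections B.invSections :=
  ⟨fun a s => ⟨transAct (fun m => LHSpace.quotLift 𝔥 (a.1 m)) (S.quotSections_lift a.2) s.1,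
    B.transAct_mem a.2 s.2⟩⟩

theorem lie_apply (a : S.quotSections) (s : B.invSections) (m : M) {x : 𝔩}
    (hx : 𝔥.toSubmodule.mkQ x = a.1 m) :
    (⁅a, s⁆ : B.invSections).1 m = (⁅x, s.1⁆ : Cₛ^∞⟮𝓘(ℝ, EM); F, E⟯) m :=
  B.act_of_mem s.2 m ((LHSpace.mk_quotLift _).trans hx.symm)

theorem sec_ext {s t : B.invSections} (h : ∀ m, s.1 m = t.1 m) : s = t :=
  Subtype.ext (ContMDiffSection.ext h)

instance : LieRingModule S.quotSections B.invSections where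
  add_lie a b s := B.sec_ext fun m => by
    have ha := LHSpace.mk_quotLift (a.1 m)
    have hb := LHSpace.mk_quotLift (b.1 m)
    change _ = (⁅a, s⁆ : B.invSections).1 m + (⁅b, s⁆ : B.invSections).1 m
    rw [B.lie_apply a s m ha, B.lie_apply b s m hb, B.lie_apply (a + b) s m
      (x := LHSpace.quotLift 𝔥 (a.1 m) + LHSpace.quotLift 𝔥 (b.1 m))
      (by rw [map_add, ha, hb]; rfl), add_lie]
    rfl
  lie_add a s t := B.sec_ext fun m => by
    have ha := LHSpace.mk_quotLift (a.1 m)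
    change _ = (⁅a, s⁆ : B.invSections).1 m + (⁅a, t⁆ : B.invSections).1 m
    rw [B.lie_apply a s m ha, B.lie_apply a t m ha, B.lie_apply a (s + t) m ha]
    exact congrArg (evalAt F m) (lie_add (LHSpace.quotLift 𝔥 (a.1 m)) s.1 t.1)
  leibniz_lie a b s := B.sec_ext fun m => by
    have ha := S.quotSections_lift a.2
    have hb := S.quotSections_lift b.2
    have h1 := B.act_transAct hb s.1 m (LHSpace.quotLift 𝔥 (a.1 m))
    have h2 := B.act_transAct ha s.1 m (LHSpace.quotLift 𝔥 (b.1 m))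
    have h3 := B.lie_apply ⁅a, b⁆ s m (x := S.transBracket (fun m => LHSpace.quotLift 𝔥 (a.1 m))
      (fun m => LHSpace.quotLift 𝔥 (b.1 m)) m) rfl
    change (⁅a, ⁅b, s⁆⁆ : B.invSections).1 m =
      (⁅⁅a, b⁆, s⁆ : B.invSections).1 m + (⁅b, ⁅a, s⁆⁆ : B.invSections).1 m
    rw [h3]
    refine h1.trans ?_
    refine Eq.trans ?_ (congrArg (_ + ·) h2.symm)
    change _ = actAt F s.1 m (⁅LHSpace.quotLift 𝔥 (a.1 m), LHSpace.quotLift 𝔥 (b.1 m)⁆ +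
      dirDeriv (fun m => LHSpace.quotLift 𝔥 (b.1 m)) m (S.lam (LHSpace.quotLift 𝔥 (a.1 m)) m) -
      dirDeriv (fun m => LHSpace.quotLift 𝔥 (a.1 m)) m (S.lam (LHSpace.quotLift 𝔥 (b.1 m)) m)) +
      (actAt F s.1 m (dirDeriv (fun m => LHSpace.quotLift 𝔥 (a.1 m)) m
        (S.lam (LHSpace.quotLift 𝔥 (b.1 m)) m)) +
      evalAt F m ⁅LHSpace.quotLift 𝔥 (b.1 m), ⁅LHSpace.quotLift 𝔥 (a.1 m), s.1⁆⁆)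
    change actAt F s.1 m (dirDeriv (fun m => LHSpace.quotLift 𝔥 (b.1 m)) m
        (S.lam (LHSpace.quotLift 𝔥 (a.1 m)) m)) +
      evalAt F m ⁅LHSpace.quotLift 𝔥 (a.1 m), ⁅LHSpace.quotLift 𝔥 (b.1 m), s.1⁆⁆ = _
    rw [map_sub, map_add, leibniz_lie (LHSpace.quotLift 𝔥 (a.1 m)), map_add]
    change _ = evalAt F m ⁅⁅LHSpace.quotLift 𝔥 (a.1 m), LHSpace.quotLift 𝔥 (b.1 m)⁆, s.1⁆ + _ - _ + _
    abel

instance : LieModule ℝ S.quotSections B.invSections where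
  smul_lie c a s := B.sec_ext fun m => by
    have ha := LHSpace.mk_quotLift (a.1 m)
    change _ = c • (⁅a, s⁆ : B.invSections).1 m
    rw [B.lie_apply a s m ha, B.lie_apply (c • a) s m (x := c • LHSpace.quotLift 𝔥 (a.1 m))
      (by rw [map_smul, ha]; rfl), smul_lie]
    rfl
  lie_smul c a s := B.sec_ext fun m => by
    have ha := LHSpace.mk_quotLift (a.1 m)
    change _ = c • (⁅a, s⁆ : B.invSections).1 m
    rw [B.lie_apply a s m ha, B.lie_apply a (c • s) m ha]
    exact congrArg (evalAt F m) (lie_smul c (LHSpace.quotLift 𝔥 (a.1 m)) s.1)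

instance : Module (LHSpace.orbitSmooth H EM M) B.invSections where
  smul f s := ⟨secSMul (LHSpace.pull f) (LHSpace.pull_smooth f) s.1, fun h => by
    ext m
    have h1 : B.ρ h s.1 m = s.1 m := by rw [s.2 h]
    rw [ρ_apply] at h1 ⊢
    change (B.T h m).symm (LHSpace.pull f (op h • m) • s.1 (op h • m)) = LHSpace.pull f m • s.1 m
    rw [map_smul, h1, LHSpace.pull_act]⟩
  one_smul s := B.sec_ext fun m => one_smul ℝ (s.1 m)
  mul_smul f g s := B.sec_ext fun m => mul_smul (LHSpace.pull f m) (LHSpace.pull g m) (s.1 m)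
  smul_zero f := B.sec_ext fun m => smul_zero (LHSpace.pull f m)
  smul_add f s t := B.sec_ext fun m => smul_add (LHSpace.pull f m) (s.1 m) (t.1 m)
  add_smul f g s := B.sec_ext fun m => add_smul (LHSpace.pull f m) (LHSpace.pull g m) (s.1 m)
  zero_smul s := B.sec_ext fun m => zero_smul ℝ (s.1 m)

instance : IsScalarTower ℝ (LHSpace.orbitSmooth H EM M) B.invSections where
  smul_assoc t f s := B.sec_ext fun m => smul_assoc t (LHSpace.pull f m) (s.1 m)

/-- `D` is a representation of the Lie algebroid `A` on `E/H`. -/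
instance : LieAlgebroidRep (LHSpace.orbitSmooth H EM M) S.quotSections B.invSections where
  smul_lie' f a s := B.sec_ext fun m => by
    have ha := LHSpace.mk_quotLift (a.1 m)
    change _ = LHSpace.pull f m • (⁅a, s⁆ : B.invSections).1 m
    rw [B.lie_apply a s m ha, B.lie_apply (f • a) s m
      (x := LHSpace.pull f m • LHSpace.quotLift 𝔥 (a.1 m)) (by rw [map_smul, ha]; rfl), smul_lie]
    rfl
  leibniz' a f s := B.sec_ext fun m => by
    have ha := LHSpace.mk_quotLift (a.1 m)
    rw [B.lie_apply a (f • s) m ha]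
    refine (B.leibniz (LHSpace.quotLift 𝔥 (a.1 m)) (LHSpace.pull f) (LHSpace.pull_smooth f)
      s.1 m).trans (add_comm _ _)

end LHBundle

end Bundle

end

/-! ### Smooth dependence of integrals on parameters -/

section ParametricIntegral

open MeasureTheory Set Filter Topology

/-! The two complexes are already isomorphic before passing to cohomology. A section of $A$ is an
equivariant map $a : M \to \mathfrak l/\mathfrak h$. A form $\eta$ on $A$ is linear over
$C^\infty(M/H)$, hence should be given by alternating forms on $\mathfrak l/\mathfrak h$ with values
in $E_m$, smooth in $m$ and equivariant; this is the same as an $H$-invariant element of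
$\wedge^k(\mathfrak l/\mathfrak h)^* \otimes \Gamma(E)$. The matching is the relation `Corresponds`:
$\eta(a)(m) = c(x)(m)$ whenever $x_i$ represents $a_i(m)$.

The analytic input is a supply of sections of $A$. Instead of trivialising $M \to M/H$ by slices,
one averages: for a bump function $\chi$ near $m_0$ and left Haar measure, $m \mapsto \int_H
\chi(mh)\, Q_h v\, dh$ is equivariant. Properness makes the integrand compactly supported in $h$,
uniformly for $m$ in a compact set; freeness concentrates it near $h = 1$ when $m = m_0$. So
equivariant maps take all values at $m_0$ (`exists_linear_equivariantMap`).

Tensoriality (`apply_eq_zero_of_eq_zero`) follows from Cramer's rule for sections $e_j$ that form a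
basis at $m_0$. Their determinant is not invariant under $H$ but changes by a character; multiplied
by an equivariant density $\delta$ with $\delta(m_0) = 1$, it gives an identity $D(e)\, a = \sum_j
D_j\, e_j$ with coefficients in $C^\infty(M/H)$, valid on all of $M$. No localisation or partition
of unity is involved.

For the differentials, lift the $a_i$ to maps $M \to \mathfrak l$. The product rule
(`exists_section_eval`) adds to $D_{a_j}\eta(\dots)$ terms with a differentiated argument, and the
bracket of $M \rtimes \mathfrak l$ adds derivative terms to $[x_i, x_j]$. By alternation these two
families cancel (`sum_update_add_sum_cons_eq_zero`), and what remains is the Chevalley–Eilenberg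
differential of $c$. -/

/-- Differentiation under an integral over a compact set. -/
theorem hasFDerivAt_setIntegral_of_continuousOn {X Y : Type*} [NormedAddCommGroup X]
    [NormedSpace ℝ X] [FiniteDimensional ℝ X] [TopologicalSpace Y] [T2Space Y] [MeasurableSpace Y]
    [BorelSpace Y] {μ : Measure Y} [IsFiniteMeasureOnCompacts μ] {U : Set X} (hU : IsOpen U)
    {K : Set Y} (hK : IsCompact K) {g : X → Y → ℝ} {g' : X → Y → X →L[ℝ] ℝ}
    (hg : ContinuousOn (fun p : X × Y => g p.1 p.2) (U ×ˢ univ))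
    (hg' : ContinuousOn (fun p : X × Y => g' p.1 p.2) (U ×ˢ univ))
    (hd : ∀ u ∈ U, ∀ y, HasFDerivAt (g · y) (g' u y) u) {u₀ : X} (hu₀ : u₀ ∈ U) :
    HasFDerivAt (fun u => ∫ y in K, g u y ∂μ) (∫ y in K, g' u₀ y ∂μ) u₀ := by
  have hprod : ∀ u ∈ U, ∀ y : Y, (u, y) ∈ U ×ˢ (univ : Set Y) := fun u hu y => ⟨hu, mem_univ y⟩
  have hcg : ∀ u ∈ U, Continuous (g u) := fun u hu =>
    hg.comp_continuous (f := fun y => (u, y)) (by fun_prop) (hprod u hu)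
  have hcg' : ∀ u ∈ U, Continuous (g' u) := fun u hu =>
    hg'.comp_continuous (f := fun y => (u, y)) (by fun_prop) (hprod u hu)
  have : ProperSpace X := FiniteDimensional.proper ℝ X
  -- On the compact set `N ×ˢ K` the derivative is bounded by some `C`, and a constant is integrable
  -- over `K`: this is the dominating function.
  obtain ⟨N, hN, hNU, hNc⟩ := local_compact_nhds (hU.mem_nhds hu₀)
  obtain ⟨C, hC⟩ := ((hNc.prod hK).bddAbove_image
    (hg'.norm.mono (prod_mono hNU (subset_univ K))))
  have hfin : IsFiniteMeasure (μ.restrict K) := ⟨by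
    rw [Measure.restrict_apply_univ]; exact hK.measure_lt_top⟩
  refine hasFDerivAt_integral_of_dominated_of_fderiv_le (bound := fun _ => C) (F' := g') hN ?_ ?_ ?_ ?_
    (integrable_const C) ?_
  · filter_upwards [hU.mem_nhds hu₀] with u hu
    exact (hcg u hu).aestronglyMeasurable
  · exact (hcg u₀ hu₀).continuousOn.integrableOn_compact hK
  · exact (hcg' u₀ hu₀).aestronglyMeasurable
  · filter_upwards [ae_restrict_mem hK.measurableSet] with y hy u hu
    exact hC ⟨(u, y), ⟨hu, hy⟩, rfl⟩
  · exact .of_forall fun y u hu => hd u (hNU hu) y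

variable {EX : Type*} [NormedAddCommGroup EX] [NormedSpace ℝ EX] [FiniteDimensional ℝ EX]
  {EY Y : Type*} [NormedAddCommGroup EY] [NormedSpace ℝ EY] [TopologicalSpace Y]
  [ChartedSpace EY Y] [IsManifold 𝓘(ℝ, EY) ∞ Y]

/-- The partial derivative of a jointly smooth function is jointly smooth. -/
theorem contMDiffAt_fderiv_fst {g : EX → Y → ℝ} {p : EX × Y}
    (hg : ContMDiffAt (𝓘(ℝ, EX).prod 𝓘(ℝ, EY)) 𝓘(ℝ, ℝ) ∞ (fun p : EX × Y => g p.1 p.2) p) :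
    ContMDiffAt (𝓘(ℝ, EX).prod 𝓘(ℝ, EY)) 𝓘(ℝ, EX →L[ℝ] ℝ) ∞
      (fun p : EX × Y => fderiv ℝ (g · p.2) p.1) p := by
  -- The parameter is the whole pair `q`, although the function depends only on `q.2`: the first
  -- component serves as the point at which the derivative is taken.
  have h := ContMDiffAt.mfderiv (J := 𝓘(ℝ, EX).prod 𝓘(ℝ, EY)) (I := 𝓘(ℝ, EX)) (I' := 𝓘(ℝ, ℝ))
    (m := ∞) (n := ∞) (x₀ := p) (fun (q : EX × Y) (u : EX) => g u q.2) Prod.fst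
    (by
      refine ContMDiffAt.comp (f := fun q : (EX × Y) × EX => (q.2, q.1.2)) (p, p.1)
        (g := fun p : EX × Y => g p.1 p.2) hg ?_
      exact contMDiffAt_snd.prodMk (contMDiffAt_snd.comp (p, p.1) contMDiffAt_fst))
    contMDiffAt_fst (by simp)
  have e := inTangentCoordinates_model_space (I := 𝓘(ℝ, EX)) (I' := 𝓘(ℝ, ℝ)) (Prod.fst : EX × Y → EX)
    (fun q => g q.1 q.2) (fun q => mfderiv 𝓘(ℝ, EX) 𝓘(ℝ, ℝ) (g · q.2) q.1) p
  refine (e ▸ h).congr_of_eventuallyEq (.of_forall fun q => ?_)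
  exact mfderiv_eq_fderiv.symm

/-- Induction on the order of differentiability: a directional derivative of the integral is again
the integral, over the same `K`, of a jointly smooth function. For this the induction must run over
all integrands at once. -/
theorem contDiffOn_setIntegral [T2Space Y] [MeasurableSpace Y]
    [BorelSpace Y] {μ : Measure Y} [IsFiniteMeasureOnCompacts μ] {U : Set EX} (hU : IsOpen U)
    {K : Set Y} (hK : IsCompact K) {g : EX → Y → ℝ}
    (hg : ContMDiffOn (𝓘(ℝ, EX).prod 𝓘(ℝ, EY)) 𝓘(ℝ, ℝ) ∞ (fun p : EX × Y => g p.1 p.2)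
      (U ×ˢ univ)) :
    ContDiffOn ℝ ∞ (fun u => ∫ y in K, g u y ∂μ) U := by
  rw [contDiffOn_infty]
  intro n
  have hdiff : ∀ g : EX → Y → ℝ, ContMDiffOn (𝓘(ℝ, EX).prod 𝓘(ℝ, EY)) 𝓘(ℝ, ℝ) ∞
      (fun p : EX × Y => g p.1 p.2) (U ×ˢ univ) → ContMDiffOn (𝓘(ℝ, EX).prod 𝓘(ℝ, EY))
      𝓘(ℝ, EX →L[ℝ] ℝ) ∞ (fun p : EX × Y => fderiv ℝ (g · p.2) p.1) (U ×ˢ univ) ∧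
      ∀ u ∈ U, HasFDerivAt (fun u => ∫ y in K, g u y ∂μ)
        (∫ y in K, fderiv ℝ (g · y) u ∂μ) u := by
    intro g hg
    have hat : ∀ u ∈ U, ∀ y : Y, ContMDiffAt (𝓘(ℝ, EX).prod 𝓘(ℝ, EY)) 𝓘(ℝ, ℝ) ∞
        (fun p : EX × Y => g p.1 p.2) (u, y) := fun u hu y =>
      hg.contMDiffAt ((hU.prod isOpen_univ).mem_nhds ⟨hu, mem_univ y⟩)
    have h1 : ContMDiffOn (𝓘(ℝ, EX).prod 𝓘(ℝ, EY))
        𝓘(ℝ, EX →L[ℝ] ℝ) ∞ (fun p : EX × Y => fderiv ℝ (g · p.2) p.1) (U ×ˢ univ) :=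
      fun p hp => (contMDiffAt_fderiv_fst (hat p.1 hp.1 p.2)).contMDiffWithinAt
    refine ⟨h1, fun u hu => hasFDerivAt_setIntegral_of_continuousOn (μ := μ)
      (g' := fun u y => fderiv ℝ (g · y) u) hU hK hg.continuousOn
      h1.continuousOn (fun v hv y => ?_) hu⟩
    have h2 : ContMDiffAt 𝓘(ℝ, EX) 𝓘(ℝ, ℝ) ∞ (g · y) v :=
      (hat v hv y).comp (f := fun v : EX => (v, y)) v (contMDiffAt_id.prodMk contMDiffAt_const)
    exact (h2.contDiffAt.differentiableAt (by simp)).hasFDerivAt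
  induction n generalizing g with
  | zero =>
    exact contDiffOn_zero.2 fun u hu =>
      ((hdiff g hg).2 u hu).continuousAt.continuousWithinAt
  | succ n ih =>
    obtain ⟨h1, h2⟩ := hdiff g hg
    push_cast
    -- In finite dimension the derivative may be tested on each vector `v`, which keeps the
    -- integrands real-valued. The second argument excludes the analytic order, which is not a
    -- natural number.
    refine contDiffOn_succ_of_fderiv_apply (fun u hu => (h2 u hu).differentiableAt.differentiableWithinAt)
      (fun h => absurd h (WithTop.natCast_ne_top n)) fun v => ?_
    have h3 : ContMDiffOn (𝓘(ℝ, EX).prod 𝓘(ℝ, EY)) 𝓘(ℝ, ℝ) ∞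
        (fun p : EX × Y => fderiv ℝ (g · p.2) p.1 v) (U ×ˢ univ) :=
      h1.clm_apply contMDiffOn_const
    refine (ih (g := fun u y => fderiv ℝ (g · y) u v) h3).congr fun u hu => ?_
    rw [fderivWithin_of_isOpen hU hu, (h2 u hu).fderiv]
    refine ContinuousLinearMap.integral_apply ?_ v
    exact (h1.continuousOn.comp_continuous (f := fun y : Y => (u, y)) (by fun_prop)
      fun y => ⟨hu, mem_univ y⟩).continuousOn.integrableOn_compact hK

variable {EM M : Type*} [NormedAddCommGroup EM] [NormedSpace ℝ EM] [FiniteDimensional ℝ EM]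
  [TopologicalSpace M] [ChartedSpace EM M] [IsManifold 𝓘(ℝ, EM) ∞ M]

/-- Integrating out a parameter preserves smoothness, provided that locally the integrand is
supported in a fixed compact set of parameters. -/
theorem contMDiff_integral [T2Space Y] [MeasurableSpace Y]
    [BorelSpace Y] {μ : Measure Y} [IsFiniteMeasureOnCompacts μ] {g : M → Y → ℝ}
    (hg : ContMDiff (𝓘(ℝ, EM).prod 𝓘(ℝ, EY)) 𝓘(ℝ, ℝ) ∞ (fun p : M × Y => g p.1 p.2))
    (hs : ∀ m₀ : M, ∃ N ∈ 𝓝 m₀, ∃ K : Set Y, IsCompact K ∧ ∀ m ∈ N, ∀ y ∉ K, g m y = 0) :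
    ContMDiff 𝓘(ℝ, EM) 𝓘(ℝ, ℝ) ∞ (fun m => ∫ y, g m y ∂μ) := by
  intro m₀
  obtain ⟨N, hN, K, hK, h0⟩ := hs m₀
  -- Near `m₀` the integral runs over one fixed compact set, so the Euclidean statement applies in a
  -- chart of `M`.
  have hset : ∀ m ∈ N, ∫ y, g m y ∂μ = ∫ y in K, g m y ∂μ := fun m hm =>
    (setIntegral_eq_integral_of_forall_compl_eq_zero fun y hy => h0 m hm y hy).symm
  refine ContMDiffAt.congr_of_eventuallyEq ?_ (eventually_of_mem hN hset)
  set e := extChartAt 𝓘(ℝ, EM) m₀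
  have hU : IsOpen e.target := isOpen_extChartAt_target m₀
  have h1 : ContMDiffOn (𝓘(ℝ, EM).prod 𝓘(ℝ, EY)) 𝓘(ℝ, ℝ) ∞
      (fun p : EM × Y => g (e.symm p.1) p.2) (e.target ×ˢ univ) :=
    hg.comp_contMDiffOn (((contMDiffOn_extChartAt_symm m₀).comp contMDiffOn_fst
      fun p hp => hp.1).prodMk contMDiffOn_snd)
  have h2 := (contDiffOn_setIntegral (μ := μ) hU hK (g := fun u y => g (e.symm u) y) h1).contMDiffOn
  have h3 := (h2.contMDiffAt (hU.mem_nhds (mem_extChartAt_target m₀))).comp m₀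
    (contMDiffAt_extChartAt (n := ∞))
  refine h3.congr_of_eventuallyEq ?_
  filter_upwards [extChartAt_source_mem_nhds (I := 𝓘(ℝ, EM)) m₀] with m hm
  simp only [Function.comp_apply]
  rw [e.left_inv hm]

end ParametricIntegral

/-! ### Proper actions and averaging over the group -/

section Averaging

open MeasureTheory Set Filter Topology

section Proper

variable {H M : Type*} [TopologicalSpace H] [Group H] [TopologicalSpace M] [MulAction Hᵐᵒᵖ M]
  [ProperSMul Hᵐᵒᵖ M]

/-- For a proper action, the elements that move a point of a compact set into another compact set
form a compact set. -/
theorem isCompact_setOf_exists_smul_mem {C N : Set M} (hC : IsCompact C) (hN : IsCompact N) :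
    IsCompact {h : H | ∃ m ∈ N, op h • m ∈ C} := by
  -- The set is the projection to the group of the preimage of `C ×ˢ N` under the proper map $(g, m)
  -- \mapsto (g m, m)$.
  have h1 := (ProperSMul.isProperMap_smul_pair (G := Hᵐᵒᵖ) (X := M)).isCompact_preimage (hC.prod hN)
  convert (h1.image continuous_fst).image continuous_unop using 1
  ext h
  constructor
  · rintro ⟨m, hm, hc⟩
    exact ⟨op h, ⟨(op h, m), ⟨hc, hm⟩, rfl⟩, rfl⟩
  · rintro ⟨g, ⟨⟨g', m⟩, ⟨hc, hm⟩, rfl⟩, rfl⟩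
    exact ⟨m, hm, hc⟩

/-- For a free and proper action, group elements that move `m₀` little are close to `1`. -/
theorem exists_nhds_forall_smul_mem [T1Space M] {m₀ : M}
    (hfree : ∀ h : H, op h • m₀ = m₀ → h = 1) {U : Set H} (hU : U ∈ 𝓝 (1 : H)) :
    ∃ W ∈ 𝓝 m₀, ∀ h : H, op h • m₀ ∈ W → h ∈ U := by
  -- Proper maps are closed, so the points $m_0 h$ with $h$ outside the interior of `U` form a
  -- closed set. By freeness it misses `m₀`, and `W` is its complement.
  have hcl : IsClosed ((op '' (interior U)ᶜ) ×ˢ ({m₀} : Set M)) :=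
    ((opHomeomorph (M := H)).isClosedMap _ isOpen_interior.isClosed_compl).prod isClosed_singleton
  have h1 := (ProperSMul.isProperMap_smul_pair (G := Hᵐᵒᵖ) (X := M)).isClosedMap _ hcl
  have h2 := h1.preimage (f := fun m : M => (m, m₀)) (by fun_prop)
  refine ⟨_, h2.isOpen_compl.mem_nhds ?_, fun h hh => ?_⟩
  · rintro ⟨⟨g, m⟩, ⟨⟨h, hh, rfl⟩, rfl⟩, he⟩
    refine hh ?_
    rw [hfree h (Prod.mk.inj he).1]
    exact mem_interior_iff_mem_nhds.2 hU
  · by_contra hn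
    exact hh ⟨(op h, m₀), ⟨⟨h, fun hi => hn (interior_subset hi), rfl⟩, rfl⟩, rfl⟩

end Proper

variable {EH H : Type*} [NormedAddCommGroup EH] [NormedSpace ℝ EH] [FiniteDimensional ℝ EH]
  [TopologicalSpace H] [ChartedSpace EH H] [Group H] [LieGroup 𝓘(ℝ, EH) ∞ H] [T2Space H]
  [SecondCountableTopology H]
  {EM M : Type*} [NormedAddCommGroup EM] [NormedSpace ℝ EM] [FiniteDimensional ℝ EM]
  [TopologicalSpace M] [ChartedSpace EM M] [IsManifold 𝓘(ℝ, EM) ∞ M] [T2Space M]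
  [MulAction Hᵐᵒᵖ M] [ProperSMul Hᵐᵒᵖ M]
  {V : Type*} [AddCommGroup V] [Module ℝ V] [FiniteDimensional ℝ V]

variable (EM M) in
/-- The smooth maps `a : M → V` with `a(m h) = h⁻¹ a(m)`. -/
def equivariantMaps (Q : Representation ℝ H V) : Submodule ℝ (M → V) where
  carrier := {a | SmoothInto EM a ∧ ∀ (m : M) (h : H), a (op h • m) = Q h⁻¹ (a m)}
  add_mem' := fun ha hb => ⟨ha.1.add hb.1, fun m h => by simp [ha.2, hb.2]⟩
  zero_mem' := ⟨.const 0, fun m h => by simp⟩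
  smul_mem' := fun t a ha => ⟨.smul contMDiff_const ha.1, fun m h => by simp [ha.2]⟩

variable (EH) in
/-- An equivariant function obtained by averaging. -/
theorem exists_equivariantMap_average
    (hact : ContMDiff (𝓘(ℝ, EM).prod 𝓘(ℝ, EH)) 𝓘(ℝ, EM) ∞ (fun p : M × H => op p.2 • p.1))
    (Q : Representation ℝ H V) (hQ : ∀ v, SmoothInto EH (fun h : H => Q h v))
    [MeasurableSpace H] [BorelSpace H] (μ : Measure H) [μ.IsMulLeftInvariant]
    [IsFiniteMeasureOnCompacts μ]
    {χ : M → ℝ} (hχ : ContMDiff 𝓘(ℝ, EM) 𝓘(ℝ, ℝ) ∞ χ) (hc : HasCompactSupport χ) (v : V) :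
    ∃ a ∈ equivariantMaps EM M Q, ∀ (φ : Module.Dual ℝ V) (m : M),
      φ (a m) = ∫ h, χ (op h • m) * φ (Q h v) ∂μ := by
  have : IsTopologicalGroup H := topologicalGroup_of_lieGroup 𝓘(ℝ, EH) ∞
  have : LocallyCompactSpace M := Manifold.locallyCompact_of_finiteDimensional 𝓘(ℝ, EM)
  have hsm : ∀ φ : Module.Dual ℝ V, ContMDiff (𝓘(ℝ, EM).prod 𝓘(ℝ, EH)) 𝓘(ℝ, ℝ) ∞
      (fun p : M × H => χ (op p.2 • p.1) * φ (Q p.2 v)) := fun φ =>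
    (hχ.comp hact).mul ((hQ v φ).comp contMDiff_snd)
  -- By properness, only a compact set of group elements moves a compact neighbourhood of `m₀` into
  -- the support of `χ`.
  have hsupp : ∀ m₀ : M, ∃ N ∈ 𝓝 m₀, ∃ K : Set H, IsCompact K ∧ ∀ (φ : Module.Dual ℝ V),
      ∀ m ∈ N, ∀ h ∉ K, χ (op h • m) * φ (Q h v) = 0 := by
    intro m₀
    obtain ⟨N, hNc, hN⟩ := exists_compact_mem_nhds m₀
    refine ⟨N, hN, _, isCompact_setOf_exists_smul_mem hc.isCompact hNc, fun φ m hm h hh => ?_⟩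
    rw [image_eq_zero_of_notMem_tsupport fun hx => hh ⟨m, hm, hx⟩, zero_mul]
  have hint : ∀ (φ : Module.Dual ℝ V) (m : M),
      Integrable (fun h => χ (op h • m) * φ (Q h v)) μ := by
    intro φ m
    obtain ⟨N, hN, K, hK, h0⟩ := hsupp m
    refine Continuous.integrable_of_hasCompactSupport ?_
      (HasCompactSupport.intro hK fun h hh => h0 φ m (mem_of_mem_nhds hN) h hh)
    exact (hsm φ).continuous.comp (f := fun h : H => (m, h)) (by fun_prop)
  set b := Module.finBasis ℝ V
  have hdual : ∀ (φ : Module.Dual ℝ V) (m : M),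
      φ (∑ i, (∫ h, χ (op h • m) * b.coord i (Q h v) ∂μ) • b i) =
        ∫ h, χ (op h • m) * φ (Q h v) ∂μ := by
    intro φ m
    simp only [map_sum, map_smul, smul_eq_mul, ← integral_mul_const]
    rw [← integral_finsetSum _ fun i _ => (hint _ m).mul_const _]
    refine integral_congr_ae (.of_forall fun h => ?_)
    simp only [sum_coord_smul φ (Q h v), Finset.mul_sum, smul_eq_mul, mul_assoc, b]
  -- This is $\int_H \chi(mh)\, Q_h v\, dh$ written in coordinates, so that only real-valued
  -- integrals occur and `V` needs no norm.
  refine ⟨fun m => ∑ i, (∫ h, χ (op h • m) * b.coord i (Q h v) ∂μ) • b i, ⟨fun φ => ?_, ?_⟩,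
    hdual⟩
  · simp only [hdual]
    refine contMDiff_integral (hsm φ) fun m₀ => ?_
    obtain ⟨N, hN, K, hK, h0⟩ := hsupp m₀
    exact ⟨N, hN, K, hK, h0 φ⟩
  · intro m g
    refine ext_dual fun φ => ?_
    -- The substitution $h \mapsto g^{-1}h$ turns $\chi(mgh)\, Q_h v$ into $\chi(mh)\, Q_{g^{-1}}
    -- Q_h v$; left invariance of the measure is what is needed.
    rw [hdual, ← LinearMap.comp_apply, hdual, ← integral_mul_left_eq_self _ g⁻¹]
    refine integral_congr_ae (.of_forall fun h => ?_)
    simp only [smul_smul, ← op_mul, mul_inv_cancel_left, map_mul]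
    rfl

variable (EH) in
/-- Equivariant smooth maps take arbitrary values at a point. -/
theorem exists_linear_equivariantMap
    (hact : ContMDiff (𝓘(ℝ, EM).prod 𝓘(ℝ, EH)) 𝓘(ℝ, EM) ∞ (fun p : M × H => op p.2 • p.1))
    (Q : Representation ℝ H V) (hQ : ∀ v, SmoothInto EH (fun h : H => Q h v)) (m₀ : M)
    (hfree : ∀ h : H, op h • m₀ = m₀ → h = 1) :
    ∃ σ : V →ₗ[ℝ] equivariantMaps EM M Q, ∀ v, (σ v).1 m₀ = v := by
  have : IsTopologicalGroup H := topologicalGroup_of_lieGroup 𝓘(ℝ, EH) ∞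
  have : LocallyCompactSpace H := Manifold.locallyCompact_of_finiteDimensional 𝓘(ℝ, EH)
  let : MeasurableSpace H := borel H
  have : BorelSpace H := ⟨rfl⟩
  let μ : Measure H := Measure.haar
  let ev : equivariantMaps EM M Q →ₗ[ℝ] V := (LinearMap.proj m₀) ∘ₗ (Submodule.subtype _)
  -- Surjectivity of the evaluation suffices: a linear map onto a vector space has a linear right
  -- inverse.
  suffices h : LinearMap.range ev = ⊤ by
    obtain ⟨σ, hσ⟩ := ev.exists_rightInverse_of_surjective h
    exact ⟨σ, fun v => LinearMap.congr_fun hσ v⟩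
  -- Otherwise a nonzero functional `φ` kills all values at `m₀`. For `v` with `φ v > 0` and a bump
  -- function concentrated enough near `m₀`, the average of `v` gives a value on which `φ` is
  -- positive.
  by_contra hne
  obtain ⟨φ, hφ, hφ'⟩ := Submodule.exists_le_ker_of_lt_top _ (lt_top_iff_ne_top.2 hne)
  obtain ⟨v, hv⟩ : ∃ v, 0 < φ v := by
    obtain ⟨w, hw⟩ := DFunLike.ne_iff.1 hφ
    rcases lt_or_gt_of_ne hw with h | h
    · exact ⟨-w, by rw [map_neg]; exact neg_pos.2 h⟩
    · exact ⟨w, h⟩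
  have hcont : Continuous (fun h : H => φ (Q h v)) := (hQ v φ).continuous
  have hU : {h : H | 0 < φ (Q h v)} ∈ 𝓝 (1 : H) :=
    (isOpen_lt continuous_const hcont).mem_nhds (by simpa using hv)
  obtain ⟨W, hW, hWU⟩ := exists_nhds_forall_smul_mem hfree hU
  obtain ⟨χ, hχW⟩ : ∃ χ : SmoothBumpFunction 𝓘(ℝ, EM) m₀, tsupport χ ⊆ W := by
    obtain ⟨χ, -, hχ⟩ := (SmoothBumpFunction.nhds_basis_tsupport (I := 𝓘(ℝ, EM)) m₀).mem_iff.1 hW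
    exact ⟨χ, hχ⟩
  obtain ⟨a, ha, haφ⟩ := exists_equivariantMap_average EH hact Q hQ μ χ.contMDiff
    χ.hasCompactSupport v
  have h0 : φ (a m₀) = 0 := hφ' ⟨⟨a, ha⟩, rfl⟩
  rw [haφ] at h0
  -- Where `χ` does not vanish, $h$ lies in the set on which $\varphi(Q_h v) > 0$; at $h = 1$ the
  -- integrand is $\varphi(v) > 0$.
  refine (Continuous.integral_pos_of_hasCompactSupport_nonneg_nonzero (μ := μ) (x := 1)
    (f := fun h : H => χ (op h • m₀) * φ (Q h v)) ?_ ?_ ?_ ?_).ne' h0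
  · refine Continuous.mul (χ.continuous.comp ?_) hcont
    exact continuous_op.smul continuous_const
  · have hK := isCompact_setOf_exists_smul_mem (H := H) χ.hasCompactSupport.isCompact
      (isCompact_singleton (x := m₀))
    refine HasCompactSupport.intro hK fun h hh => ?_
    rw [image_eq_zero_of_notMem_tsupport fun hx => hh ⟨m₀, rfl, hx⟩, zero_mul]
  · intro h
    by_cases hh : χ (op h • m₀) = 0
    · simp [hh]
    · exact mul_nonneg χ.nonneg (hWU h (hχW (subset_tsupport _ hh))).le
  · simp [hv.ne']

end Averaging

/-! ### Cramer's rule -/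

section Cramer

/-- Cramer's rule for a family of vectors. -/
theorem Module.Basis.det_smul_eq_sum {ι K V : Type*} [Fintype ι] [DecidableEq ι] [CommRing K]
    [AddCommGroup V] [Module K V] (b : Module.Basis ι K V) (e : ι → V) (x : V) :
    b.det e • x = ∑ j, b.det (Function.update e j x) • e j := by
  refine b.repr.injective (Finsupp.ext fun i => ?_)
  -- Written in the coordinates of `b`, the claim is the matrix identity $A \cdot \mathrm{cramer}(A,
  -- x) = \det(A)\, x$.
  have h := congrFun (Matrix.mulVec_cramer (b.toMatrix e) (b.repr x)) i
  simp only [Matrix.mulVec, dotProduct, Matrix.cramer_apply, ← b.toMatrix_update] at h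
  simp only [map_sum, map_smul, Finsupp.coe_finsetSum, Finset.sum_apply, Finsupp.smul_apply,
    smul_eq_mul, Module.Basis.det_apply] at h ⊢
  rw [Pi.smul_apply, smul_eq_mul] at h
  rw [← h]
  exact Finset.sum_congr rfl fun j _ => mul_comm _ _

theorem SmoothInto.basis_det {EM M : Type*} [NormedAddCommGroup EM] [NormedSpace ℝ EM]
    [TopologicalSpace M] [ChartedSpace EM M] [IsManifold 𝓘(ℝ, EM) ∞ M] {V : Type*}
    [AddCommGroup V] [Module ℝ V] [FiniteDimensional ℝ V] {ι : Type*} [Fintype ι] [DecidableEq ι]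
    (b : Module.Basis ι ℝ V) {e : ι → M → V} (he : ∀ i, SmoothInto EM (e i)) :
    ContMDiff 𝓘(ℝ, EM) 𝓘(ℝ, ℝ) ∞ (fun m => b.det fun i => e i m) := by
  simp only [Module.Basis.det_apply, Matrix.det_apply', Module.Basis.toMatrix_apply]
  exact contMDiff_finsetSum fun τ _ => contMDiff_const.mul
    (contMDiff_finsetProd fun i _ => he i (b.coord (τ i)))

end Cramer

/-! ### Sections and densities for $A$ -/

section Frames

variable {𝔩 : Type*} [LieRing 𝔩] [LieAlgebra ℝ 𝔩] [FiniteDimensional ℝ 𝔩] {𝔥 : LieSubalgebra ℝ 𝔩}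
  {EH : Type*} [NormedAddCommGroup EH] [NormedSpace ℝ EH]
  {H : Type*} [TopologicalSpace H] [ChartedSpace EH H] [Group H] [LieGroup 𝓘(ℝ, EH) ∞ H]
  (P : LieGroupPair 𝔥 EH H)

/-- The representation of `H` on `𝔩/𝔥`. -/
def LieGroupPair.quotRep : Representation ℝ H (𝔩 ⧸ 𝔥.toSubmodule) where
  toFun := P.quotAd
  map_one' := Submodule.linearMap_qext _ (LinearMap.ext fun x => by
    simp [LieGroupPair.quotAd])
  map_mul' g h := Submodule.linearMap_qext _ (LinearMap.ext fun x => by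
    simp [LieGroupPair.quotAd])

theorem LieGroupPair.quotRep_smooth (v : 𝔩 ⧸ 𝔥.toSubmodule) :
    SmoothInto EH (fun h : H => P.quotRep h v) := by
  obtain ⟨x, rfl⟩ := 𝔥.toSubmodule.mkQ_surjective v
  exact (P.Ad_smooth x).linear 𝔥.toSubmodule.mkQ

/-- The determinant of an endomorphism is `b.det` of the images of the basis vectors, hence a
polynomial in smooth coordinates. This makes averaging available for the character `detCharacter`.
-/
theorem LieGroupPair.det_quotRep_smooth :
    ContMDiff 𝓘(ℝ, EH) 𝓘(ℝ, ℝ) ∞ (fun h : H => LinearMap.det (P.quotRep h)) := by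
  set b := Module.finBasis ℝ (𝔩 ⧸ 𝔥.toSubmodule)
  have h : (fun h : H => LinearMap.det (P.quotRep h)) = fun h => b.det fun i => P.quotRep h (b i) := by
    ext h
    have := b.det_comp (P.quotRep h) b
    rw [b.det_self, mul_one] at this
    exact this.symm
  rw [h]
  exact SmoothInto.basis_det b fun i => P.quotRep_smooth (b i)

/-- The character of `H` by which the determinant of a frame of `A` has to be corrected. -/
noncomputable def LieGroupPair.detCharacter : Representation ℝ H ℝ where
  -- With the inverse, the equivariant maps satisfy $\delta(mh) = \det(Q_h)\, \delta(m)$, which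
  -- cancels the factor $\det(Q_{h^{-1}})$ of the determinant of a frame. Inversion preserves
  -- multiplicativity since the values commute.
  toFun h := LinearMap.det (P.quotRep h⁻¹) • LinearMap.id
  map_one' := by simp; rfl
  map_mul' g h := by
    ext
    simp [mul_comm]

variable [FiniteDimensional ℝ EH] [T2Space H] [SecondCountableTopology H]
  {EM : Type*} [NormedAddCommGroup EM] [NormedSpace ℝ EM] [FiniteDimensional ℝ EM]
  {M : Type*} [TopologicalSpace M] [ChartedSpace EM M] [IsManifold 𝓘(ℝ, EM) ∞ M]
  [T2Space M] [MulAction Hᵐᵒᵖ M] [ProperSMul Hᵐᵒᵖ M]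

variable {P} in
/-- A family of sections of `A`, depending linearly on its values at `m₀`. -/
theorem LHSpace.exists_sections_through (S : LHSpace P EM M)
    (hfree : ∀ (m : M) (h : H), op h • m = m → h = 1) (m₀ : M) :
    ∃ σ : (𝔩 ⧸ 𝔥.toSubmodule) →ₗ[ℝ] S.quotSections, ∀ v, (σ v).1 m₀ = v :=
  exists_linear_equivariantMap EH S.smooth_act P.quotRep P.quotRep_smooth m₀ (hfree m₀)

variable {P} in
/-- A function on `M` that corrects the determinant of a frame of `A` to an invariant function. -/
theorem LHSpace.exists_density (S : LHSpace P EM M)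
    (hfree : ∀ (m : M) (h : H), op h • m = m → h = 1) (m₀ : M) :
    ∃ δ : M → ℝ, ContMDiff 𝓘(ℝ, EM) 𝓘(ℝ, ℝ) ∞ δ ∧
      (∀ (m : M) (h : H), δ (op h • m) = LinearMap.det (P.quotRep h) * δ m) ∧ δ m₀ = 1 := by
  have hs : ∀ v : ℝ, SmoothInto EH (fun h : H => P.detCharacter h v) := fun v φ => by
    have : (fun h : H => φ (P.detCharacter h v)) = fun h : H =>
        LinearMap.det (P.quotRep h⁻¹) * φ v := by
      ext h
      exact map_smul φ (LinearMap.det (P.quotRep h⁻¹)) v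
    rw [this]
    exact (P.det_quotRep_smooth.comp (contMDiff_inv 𝓘(ℝ, EH) ∞)).mul contMDiff_const
  obtain ⟨σ, hσ⟩ := exists_linear_equivariantMap EH S.smooth_act P.detCharacter hs m₀ (hfree m₀)
  refine ⟨(σ 1).1, (σ 1).2.1 LinearMap.id, fun m h => ?_, hσ 1⟩
  rw [(σ 1).2.2]
  simp [LieGroupPair.detCharacter]

end Frames

/-- The arguments are exchanged one at a time; each exchange changes the value by a term with the
difference `x i - x' i` in slot `i`. It serves both for tensoriality of forms on $A$ and for passing
from $\mathfrak l$ to $\mathfrak l/\mathfrak h$. -/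
theorem MultilinearMap.eq_of_forall_update_sub {R ι N W : Type*} [Ring R] [AddCommGroup N]
    [Module R N] [AddCommGroup W] [Module R W] [Fintype ι] [DecidableEq ι]
    (f : MultilinearMap R (fun _ : ι => N) W) {x x' : ι → N}
    (h : ∀ (y : ι → N) (i : ι), f (Function.update y i (x i - x' i)) = 0) : f x = f x' := by
  have key : ∀ s : Finset ι, f (s.piecewise x x') = f x' := by
    intro s
    induction s using Finset.induction_on with
    | empty => simp
    | insert i s hi ih =>
      have h1 := h (s.piecewise x x') i
      rw [f.map_update_sub, sub_eq_zero] at h1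
      rw [Finset.piecewise_insert, h1, ← ih]
      congr 1
      rw [Function.update_eq_self_iff, Finset.piecewise_eq_of_notMem _ _ _ hi]
  simpa using key Finset.univ

/-! ### Forms on $A$ are pointwise -/

section Tensoriality

variable {𝔩 : Type*} [LieRing 𝔩] [LieAlgebra ℝ 𝔩] [FiniteDimensional ℝ 𝔩] {𝔥 : LieSubalgebra ℝ 𝔩}
  {EH : Type*} [NormedAddCommGroup EH] [NormedSpace ℝ EH] [FiniteDimensional ℝ EH]
  {H : Type*} [TopologicalSpace H] [ChartedSpace EH H] [Group H] [LieGroup 𝓘(ℝ, EH) ∞ H]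
  [T2Space H] [SecondCountableTopology H] {P : LieGroupPair 𝔥 EH H}
  {EM : Type*} [NormedAddCommGroup EM] [NormedSpace ℝ EM] [FiniteDimensional ℝ EM]
  {M : Type*} [TopologicalSpace M] [ChartedSpace EM M] [IsManifold 𝓘(ℝ, EM) ∞ M]
  [T2Space M] [MulAction Hᵐᵒᵖ M]
  {S : LHSpace P EM M}
  {F : Type*} [NormedAddCommGroup F] [NormedSpace ℝ F]
  {E : M → Type*} [TopologicalSpace (TotalSpace F E)] [∀ m, TopologicalSpace (E m)]
  [FiberBundle F E] [∀ m, AddCommGroup (E m)] [∀ m, Module ℝ (E m)] [VectorBundle ℝ F E]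
  [LieRingModule 𝔩 Cₛ^∞⟮𝓘(ℝ, EM); F, E⟯] [LieModule ℝ 𝔩 Cₛ^∞⟮𝓘(ℝ, EM); F, E⟯]
  (B : LHBundle F E S) {k : ℕ}

namespace LHBundle

/-- The value at a point of a linear map `Γ(A) → Γ(E/H)` depends only on the value of the argument
at that point. -/
theorem apply_eq_zero_of_eq_zero [ProperSMul Hᵐᵒᵖ M]
    (hfree : ∀ (m : M) (h : H), op h • m = m → h = 1)
    (T : S.quotSections →ₗ[LHSpace.orbitSmooth H EM M] B.invSections) {a : S.quotSections} {m₀ : M}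
    (ha : a.1 m₀ = 0) : (T a).1 m₀ = 0 := by
  obtain ⟨σ, hσ⟩ := S.exists_sections_through hfree m₀
  obtain ⟨δ, hδ, hδH, hδ₀⟩ := S.exists_density hfree m₀
  set b := Module.finBasis ℝ (𝔩 ⧸ 𝔥.toSubmodule)
  have hinv : ∀ c : Fin _ → S.quotSections, ∀ (m : M) (h : H),
      δ (op h • m) * b.det (fun i => (c i).1 (op h • m)) = δ m * b.det (fun i => (c i).1 m) := by
    intro c m h
    have h1 : (fun i => (c i).1 (op h • m)) = P.quotRep h⁻¹ ∘ fun i => (c i).1 m :=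
      funext fun i => (c i).2.2 m h
    have h2 : LinearMap.det (P.quotRep h) * LinearMap.det (P.quotRep h⁻¹) = 1 := by
      rw [← map_mul, ← map_mul, mul_inv_cancel, map_one, map_one]
    rw [h1, b.det_comp, hδH]
    linear_combination (δ m * b.det fun i => (c i).1 m) * h2
  -- The determinant corrected by `δ` is invariant, so it descends to a function on $M/H$, over
  -- which `T` is linear.
  let D : (Fin _ → S.quotSections) → LHSpace.orbitSmooth H EM M := fun c =>
    LHSpace.descend (fun m => δ m * b.det (fun i => (c i).1 m))
      (hδ.mul (SmoothInto.basis_det b fun i => (c i).2.1)) (hinv c)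
  have hD : ∀ c m, LHSpace.pull (D c) m = δ m * b.det (fun i => (c i).1 m) := fun _ _ => rfl
  let e : Fin _ → S.quotSections := fun i => σ (b i)
  have hupd : ∀ j m, (fun i => (Function.update e j a i).1 m) =
      Function.update (fun i => (e i).1 m) j (a.1 m) := by
    intro j m
    ext1 i
    rcases eq_or_ne i j with rfl | hij
    · simp
    · simp [hij]
  -- Cramer's rule holds everywhere, also where the `e j` fail to be a frame.
  have hsum : D e • a = ∑ j, D (Function.update e j a) • e j := by
    refine Subtype.ext (funext fun m => ?_)
    have h1 := congrArg (δ m • ·) (b.det_smul_eq_sum (fun i => (e i).1 m) (a.1 m))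
    simp only [Finset.smul_sum, smul_smul] at h1
    change (δ m * b.det (fun i => (e i).1 m)) • a.1 m = _
    rw [h1, AddSubmonoidClass.coe_finsetSum, Finset.sum_apply]
    refine Finset.sum_congr rfl fun j _ => ?_
    change _ = (δ m * b.det (fun i => (Function.update e j a i).1 m)) • (e j).1 m
    rw [hupd]
  have h2 := congrArg (fun s : B.invSections => evalAt F m₀ s.1) (congrArg T hsum)
  simp only [map_sum, map_smul, AddSubmonoidClass.coe_finsetSum] at h2
  have h3 : ∀ (f : LHSpace.orbitSmooth H EM M) (s : B.invSections),
    evalAt F m₀ (f • s).1 = LHSpace.pull f m₀ • s.1 m₀ := fun _ _ => rfl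
  simp only [h3, hD, hupd, ha] at h2
  have h4 : ∀ j, b.det (Function.update (fun i => (e i).1 m₀) j 0) = 0 := fun j =>
    b.det.map_update_zero _ _
  have h5 : (fun i => (e i).1 m₀) = b := funext fun i => hσ (b i)
  -- At `m₀` the coefficient of `T a` is 1, and every coefficient on the right vanishes because the
  -- determinant has the entry `a.1 m₀ = 0`.
  simpa [h4, h5, hδ₀, b.det_self] using h2

/-- The value at a point of an alternating form on `A` with values in `E/H`. -/
noncomputable def formAt (η : S.quotSections [⋀^Fin k]→ₗ[LHSpace.orbitSmooth H EM M] B.invSections) (m : M) :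
    S.quotSections [⋀^Fin k]→ₗ[ℝ] E m where
  toFun a := (η a).1 m
  map_update_add' a i x y := by
    rw [η.map_update_add]
    rfl
  map_update_smul' a i t x := by
    have h : t • x = algebraMap ℝ (LHSpace.orbitSmooth H EM M) t • x := rfl
    rw [h, η.map_update_smul]
    rfl
  map_eq_zero_of_eq' a i j h hij := by
    rw [η.map_eq_zero_of_eq a h hij]
    rfl

/-- With the other arguments fixed, each slot is a $C^\infty(M/H)$-linear map, to which
`apply_eq_zero_of_eq_zero` applies. -/
theorem formAt_congr [ProperSMul Hᵐᵒᵖ M] (hfree : ∀ (m : M) (h : H), op h • m = m → h = 1)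
    (η : S.quotSections [⋀^Fin k]→ₗ[LHSpace.orbitSmooth H EM M] B.invSections) {m : M}
    {a a' : Fin k → S.quotSections} (h : ∀ i, (a i).1 m = (a' i).1 m) :
    (η a).1 m = (η a').1 m :=
  (B.formAt η m).toMultilinearMap.eq_of_forall_update_sub fun y i =>
    B.apply_eq_zero_of_eq_zero hfree (η.toMultilinearMap.toLinearMap y i)
      (sub_eq_zero.2 (h i) : (a i - a' i).1 m = 0)

/-- The forms on the fibres `𝔩/𝔥` of `A` that are induced by a form on the sections. -/
theorem exists_fibre_form [ProperSMul Hᵐᵒᵖ M] (hfree : ∀ (m : M) (h : H), op h • m = m → h = 1)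
    (η : S.quotSections [⋀^Fin k]→ₗ[LHSpace.orbitSmooth H EM M] B.invSections) (m : M) :
    ∃ α : (𝔩 ⧸ 𝔥.toSubmodule) [⋀^Fin k]→ₗ[ℝ] E m, ∀ a : Fin k → S.quotSections,
      (η a).1 m = α fun i => (a i).1 m := by
  obtain ⟨σ, hσ⟩ := S.exists_sections_through hfree m
  -- Linearity of `σ` makes the fibre form multilinear; by tensoriality, replacing each section by
  -- the `σ`-section with the same value at `m` changes nothing.
  exact ⟨(B.formAt η m).compLinearMap σ, fun a => B.formAt_congr hfree η fun i => (hσ _).symm⟩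

end LHBundle

end Tensoriality

/-! ### The product rule for evaluated cochains -/

section ProductRule

variable {𝔩 : Type*} [LieRing 𝔩] [LieAlgebra ℝ 𝔩] [FiniteDimensional ℝ 𝔩] {𝔥 : LieSubalgebra ℝ 𝔩}
  {EH : Type*} [NormedAddCommGroup EH] [NormedSpace ℝ EH]
  {H : Type*} [TopologicalSpace H] [ChartedSpace EH H] [Group H] [LieGroup 𝓘(ℝ, EH) ∞ H]
  {P : LieGroupPair 𝔥 EH H}
  {EM : Type*} [NormedAddCommGroup EM] [NormedSpace ℝ EM] [FiniteDimensional ℝ EM]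
  {M : Type*} [TopologicalSpace M] [ChartedSpace EM M] [IsManifold 𝓘(ℝ, EM) ∞ M]
  [MulAction Hᵐᵒᵖ M]
  {S : LHSpace P EM M}
  {F : Type*} [NormedAddCommGroup F] [NormedSpace ℝ F]
  {E : M → Type*} [TopologicalSpace (TotalSpace F E)] [∀ m, TopologicalSpace (E m)]
  [FiberBundle F E] [∀ m, AddCommGroup (E m)] [∀ m, Module ℝ (E m)] [VectorBundle ℝ F E]
  [LieRingModule 𝔩 Cₛ^∞⟮𝓘(ℝ, EM); F, E⟯] [LieModule ℝ 𝔩 Cₛ^∞⟮𝓘(ℝ, EM); F, E⟯]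

/-- Inserting sections of `M ⋊ 𝔩` into a multilinear map `𝔩ᵏ → Γ(E)` gives a smooth section, which
is differentiated by the product rule. -/
theorem LHBundle.exists_section_eval (B : LHBundle F E S) {k : ℕ}
    (c : MultilinearMap ℝ (fun _ : Fin k => 𝔩) Cₛ^∞⟮𝓘(ℝ, EM); F, E⟯) {a : Fin k → M → 𝔩}
    (ha : ∀ i, SmoothInto EM (a i)) :
    ∃ s : Cₛ^∞⟮𝓘(ℝ, EM); F, E⟯, (∀ m, s m = c (fun i => a i m) m) ∧ ∀ (x : 𝔩) (m : M),
      (⁅x, s⁆ : Cₛ^∞⟮𝓘(ℝ, EM); F, E⟯) m =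
        (⁅x, c fun i => a i m⁆ : Cₛ^∞⟮𝓘(ℝ, EM); F, E⟯) m +
          ∑ r, c (Function.update (fun i => a i m) r (dirDeriv (a r) m (S.lam x m))) m := by
  induction k with
  | zero =>
    refine ⟨c fun i => i.elim0, fun m => ?_, fun x m => ?_⟩
    · congr 2; exact Subsingleton.elim _ _
    · simp only [Finset.univ_eq_empty, Finset.sum_empty, add_zero]
      congr 3; exact Subsingleton.elim _ _
  | succ k ih =>
    set b := Module.finBasis ℝ 𝔩
    -- The first argument is expanded in the basis: $c(a_0, a_1, \dots) = \sum_j b^j(a_0)\, c(b_j,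
    -- a_1, \dots)$. The induction hypothesis handles each $c(b_j, \cdot)$, and the Leibniz rule of
    -- $E$ handles the coefficients.
    choose s hs hs' using fun j => ih (c.curryLeft (b j)) fun i => ha i.succ
    have hcons : ∀ m, (fun i => a i m) = Fin.cons (a 0 m) fun i => a i.succ m := fun m =>
      (Fin.cons_self_tail fun i => a i m).symm
    let L : (Fin k → 𝔩) → 𝔩 →ₗ[ℝ] Cₛ^∞⟮𝓘(ℝ, EM); F, E⟯ := fun w =>
      { toFun := fun v => c (Fin.cons v w)
        map_add' := fun v v' => c.cons_add w v v'
        map_smul' := fun t v => c.cons_smul w t v }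
    have hsL : ∀ j m, s j m = evalAt F m (L (fun i => a i.succ m) (b j)) := hs
    have hsL' : ∀ j x m, (⁅x, s j⁆ : Cₛ^∞⟮𝓘(ℝ, EM); F, E⟯) m =
        evalAt F m (LieModule.toEnd ℝ 𝔩 _ x (L (fun i => a i.succ m) (b j))) +
        ∑ r, evalAt F m (L (Function.update (fun i => a i.succ m) r
          (dirDeriv (a r.succ) m (S.lam x m))) (b j)) := hs'
    refine ⟨∑ j, secSMul (fun m => b.coord j (a 0 m)) (ha 0 _) (s j), fun m => ?_, fun x m => ?_⟩
    · change evalAt F m _ = evalAt F m _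
      rw [map_sum, hcons]
      refine Eq.trans ?_ (sum_coord_smul (evalAt F m ∘ₗ L fun i => a i.succ m) (a 0 m)).symm
      exact Finset.sum_congr rfl fun j _ => congrArg _ (hsL j m)
    · have h1 : (⁅x, ∑ j, secSMul (fun m => b.coord j (a 0 m)) (ha 0 _) (s j)⁆ :
          Cₛ^∞⟮𝓘(ℝ, EM); F, E⟯) m = ∑ j, (mvfderiv 𝓘(ℝ, EM) (fun m => b.coord j (a 0 m)) m
            (S.lam x m) • s j m + b.coord j (a 0 m) • (⁅x, s j⁆ : Cₛ^∞⟮𝓘(ℝ, EM); F, E⟯) m) := by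
        rw [lie_sum]
        change evalAt F m _ = _
        rw [map_sum]
        exact Finset.sum_congr rfl fun j _ => B.leibniz x _ (ha 0 _) (s j) m
      rw [h1, Fin.sum_univ_succ, hcons]
      simp only [← Fin.cons_update, Fin.update_cons_zero]
      -- The three groups are the action on the value, the derivative of `a 0`, and the derivatives
      -- of the later arguments. Each is a linear map applied to a vector in the first slot, so that
      -- it can be expanded in the same basis.
      change _ = (evalAt F m ∘ₗ (LieModule.toEnd ℝ 𝔩 _ x) ∘ₗ L fun i => a i.succ m) (a 0 m) +
        ((evalAt F m ∘ₗ L fun i => a i.succ m) (dirDeriv (a 0) m (S.lam x m)) +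
        ∑ r, (evalAt F m ∘ₗ L (Function.update (fun i => a i.succ m) r
          (dirDeriv (a r.succ) m (S.lam x m)))) (a 0 m))
      rw [sum_coord_smul (evalAt F m ∘ₗ (LieModule.toEnd ℝ 𝔩 _ x) ∘ₗ L fun i => a i.succ m),
        sum_coord_smul (evalAt F m ∘ₗ L fun i => a i.succ m) (dirDeriv (a 0) m (S.lam x m)),
        Finset.sum_congr rfl fun r _ => sum_coord_smul (evalAt F m ∘ₗ L (Function.update
          (fun i => a i.succ m) r (dirDeriv (a r.succ) m (S.lam x m)))) (a 0 m)]
      simp only [hsL, hsL', ← dual_dirDeriv (ha 0), smul_add, Finset.sum_add_distrib,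
        Finset.smul_sum]
      rw [Finset.sum_comm]
      exact add_left_comm _ _ _

end ProductRule

/-! ### Cancellation of the derivative terms -/

section Koszul

/-- Moving the entry in position `r` to the front past `r` others costs the sign $(-1)^r$. -/
theorem AlternatingMap.map_update_eq_neg_one_pow_smul_cons {N W : Type*} [AddCommGroup N]
    [Module ℝ N] [AddCommGroup W] [Module ℝ W] {k : ℕ} (f : N [⋀^Fin (k + 1)]→ₗ[ℝ] W)
    (x : Fin (k + 1) → N) (r : Fin (k + 1)) (y : N) :
    f (Function.update x r y) =
      (-1 : ℝ) ^ (r : ℕ) • f (Fin.cons y fun s => x (r.succAbove s)) := by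
  rw [← Fin.insertNth_removeNth, f.map_insertNth]
  change _ • f (Fin.cons y fun s => x (r.succAbove s)) = _
  rcases Nat.even_or_odd (r : ℕ) with h | h <;> simp [h.neg_one_pow]

/-- The terms with derivatives of the arguments cancel in the differential of a form. -/
theorem AlternatingMap.sum_update_add_sum_cons_eq_zero {N W : Type*} [AddCommGroup N]
    [Module ℝ N] [AddCommGroup W] [Module ℝ W] {k : ℕ} (f : N [⋀^Fin (k + 1)]→ₗ[ℝ] W)
    (x : Fin (k + 2) → N) (y : Fin (k + 2) → Fin (k + 2) → N) :
    ∑ j : Fin (k + 2), (-1 : ℝ) ^ (j : ℕ) • ∑ r : Fin (k + 1),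
        f (Function.update (fun r => x (j.succAbove r)) r (y j (j.succAbove r))) +
      ∑ i : Fin (k + 1), ∑ j : Fin (k + 2), (if i.castSucc < j then
        (-1 : ℝ) ^ ((i : ℕ) + (j : ℕ)) • f (Fin.cons (y i.castSucc j - y j i.castSucc)
          fun r => x (j.succAbove (i.succAbove r))) else 0) = 0 := by
  simp only [Finset.smul_sum]
  -- The pairs (removed index, differentiated index) are grouped by unordered pairs of distinct
  -- positions; each group meets one term of the bracket sum.
  rw [Fin.sum_sum_eq_sum_triangle_add, ← Finset.sum_add_distrib]
  refine Finset.sum_eq_zero fun i _ => ?_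
  -- The larger position is written `j.succ` with `i ≤ j`, as in the triangular sum.
  have h1 : ∀ g : Fin (k + 2) → W, (∑ j, if i.castSucc < j then g j else 0) =
      ∑ j ∈ Finset.Ici i, g j.succ := by
    intro g
    rw [Fin.sum_univ_succ, if_neg (by simp), zero_add, ← Finset.sum_filter]
    refine Finset.sum_congr ?_ fun _ _ => rfl
    ext j
    simp [Fin.castSucc_lt_succ_iff]
  rw [h1, ← Finset.sum_add_distrib]
  refine Finset.sum_eq_zero fun j hj => ?_
  rw [Finset.mem_Ici] at hj
  have H₁ : i.castSucc.succAbove j = j.succ := by simp [Fin.succAbove_of_le_castSucc, hj]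
  have H₂ : j.predAbove i.castSucc = i := by simp [Fin.predAbove_of_le_castSucc, hj]
  have H₃ : j.succ.succAbove i = i.castSucc := by simp [Fin.succAbove_of_castSucc_lt, hj]
  have H₄ : ∀ r, i.castSucc.succAbove (j.succAbove r) = j.succ.succAbove (i.succAbove r) := by
    intro r
    have := Fin.succAbove_succAbove_succAbove_predAbove i.castSucc j r
    rw [H₁, H₂] at this
    exact this.symm
  have h2 : f (Fin.cons (y i.castSucc j.succ - y j.succ i.castSucc)
      fun r => x (j.succ.succAbove (i.succAbove r))) =
      f (Fin.cons (y i.castSucc j.succ) fun r => x (j.succ.succAbove (i.succAbove r))) -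
      f (Fin.cons (y j.succ i.castSucc) fun r => x (j.succ.succAbove (i.succAbove r))) := by
    have := f.map_update_sub
      (Fin.cons 0 fun r => x (j.succ.succAbove (i.succAbove r))) 0 (y i.castSucc j.succ)
      (y j.succ i.castSucc)
    simpa only [Fin.update_cons_zero] using this
  -- For positions $i$ and $j+1$, the product rule gives $y_{i,j+1}$ the sign $(-1)^{i+j}$ and
  -- $y_{j+1,i}$ the sign $(-1)^{i+j+1}$; the bracket sum contributes $(-1)^{i+j+1}(y_{i,j+1} -
  -- y_{j+1,i})$.
  simp only [f.map_update_eq_neg_one_pow_smul_cons, H₁, H₃, H₄, h2, Fin.val_castSucc, Fin.val_succ,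
    pow_add, pow_one]
  module

end Koszul

/-! ### From relative cochains to forms on $A$ -/

section Correspondence

variable {𝔩 : Type*} [LieRing 𝔩] [LieAlgebra ℝ 𝔩] [FiniteDimensional ℝ 𝔩] {𝔥 : LieSubalgebra ℝ 𝔩}
  {EH : Type*} [NormedAddCommGroup EH] [NormedSpace ℝ EH] [FiniteDimensional ℝ EH]
  {H : Type*} [TopologicalSpace H] [ChartedSpace EH H] [Group H] [LieGroup 𝓘(ℝ, EH) ∞ H]
  [T2Space H] [SecondCountableTopology H] {P : LieGroupPair 𝔥 EH H}
  {EM : Type*} [NormedAddCommGroup EM] [NormedSpace ℝ EM] [FiniteDimensional ℝ EM]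
  {M : Type*} [TopologicalSpace M] [ChartedSpace EM M] [IsManifold 𝓘(ℝ, EM) ∞ M]
  [T2Space M] [MulAction Hᵐᵒᵖ M]
  {S : LHSpace P EM M}
  {F : Type*} [NormedAddCommGroup F] [NormedSpace ℝ F]
  {E : M → Type*} [TopologicalSpace (TotalSpace F E)] [∀ m, TopologicalSpace (E m)]
  [FiberBundle F E] [∀ m, AddCommGroup (E m)] [∀ m, Module ℝ (E m)] [VectorBundle ℝ F E]
  [LieRingModule 𝔩 Cₛ^∞⟮𝓘(ℝ, EM); F, E⟯] [LieModule ℝ 𝔩 Cₛ^∞⟮𝓘(ℝ, EM); F, E⟯]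
  (B : LHBundle F E S) {k : ℕ}

namespace LHBundle

/-- A relative cochain `c` and a form `η` on `A` correspond to each other if they have the same
values at every point of `M`. -/
def Corresponds (c : (Fin k → 𝔩) → Cₛ^∞⟮𝓘(ℝ, EM); F, E⟯)
    (η : (Fin k → S.quotSections) → B.invSections) : Prop :=
  ∀ (a : Fin k → S.quotSections) (x : Fin k → 𝔩) (m : M),
    (∀ i, 𝔥.toSubmodule.mkQ (x i) = (a i).1 m) → (η a).1 m = c x m

variable {B}

theorem Corresponds.add {c c' : (Fin k → 𝔩) → Cₛ^∞⟮𝓘(ℝ, EM); F, E⟯}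
    {η η' : (Fin k → S.quotSections) → B.invSections} (h : B.Corresponds c η)
    (h' : B.Corresponds c' η') : B.Corresponds (c + c') (η + η') := fun a x m hx =>
  congrArg₂ (· + ·) (h a x m hx) (h' a x m hx)

theorem Corresponds.smul {c : (Fin k → 𝔩) → Cₛ^∞⟮𝓘(ℝ, EM); F, E⟯}
    {η : (Fin k → S.quotSections) → B.invSections} (h : B.Corresponds c η) (t : ℝ) :
    B.Corresponds (t • c) (t • η) := fun a x m hx => congrArg (t • ·) (h a x m hx)

/-- The values of sections of $A$ at a point always have representatives in $\mathfrak l$, so `c`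
determines `η`. -/
theorem Corresponds.right_unique {c : (Fin k → 𝔩) → Cₛ^∞⟮𝓘(ℝ, EM); F, E⟯}
    {η η' : (Fin k → S.quotSections) → B.invSections} (h : B.Corresponds c η)
    (h' : B.Corresponds c η') : η = η' := funext fun a => B.sec_ext fun m => by
  have hx := fun i => LHSpace.mk_quotLift ((a i).1 m)
  rw [h a _ m hx, h' a _ m hx]

/-- Conversely, every tuple in $\mathfrak l$ has to represent the values at `m` of global sections
of $A$. This rests on the averaging construction, hence on the action being free and proper. -/
theorem Corresponds.left_unique [ProperSMul Hᵐᵒᵖ M]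
    (hfree : ∀ (m : M) (h : H), op h • m = m → h = 1)
    {c c' : (Fin k → 𝔩) → Cₛ^∞⟮𝓘(ℝ, EM); F, E⟯}
    {η : (Fin k → S.quotSections) → B.invSections} (h : B.Corresponds c η)
    (h' : B.Corresponds c' η) : c = c' := funext fun x => ContMDiffSection.ext fun m => by
  obtain ⟨σ, hσ⟩ := S.exists_sections_through hfree m
  have hx := fun i => (hσ (𝔥.toSubmodule.mkQ (x i))).symm
  rw [← h _ x m hx, ← h' _ x m hx]

/-- A relative cochain vanishes on arguments in $\mathfrak h$, so it depends only on classes in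
$\mathfrak l/\mathfrak h$. -/
theorem relativeCochains_congr {c : (Fin k → 𝔩) → Cₛ^∞⟮𝓘(ℝ, EM); F, E⟯}
    (hc : c ∈ relativeCochains 𝔥 P.Ad B.ρ k) {x x' : Fin k → 𝔩}
    (h : ∀ i, 𝔥.toSubmodule.mkQ (x i) = 𝔥.toSubmodule.mkQ (x' i)) : c x = c x' := by
  obtain ⟨⟨f, hf⟩, h0, -⟩ := hc
  rw [hf, hf]
  refine f.toMultilinearMap.eq_of_forall_update_sub fun y i => ?_
  refine (hf _).symm.trans (h0 _ ⟨i, ?_⟩)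
  rw [Function.update_self]
  exact (Submodule.Quotient.eq _).1 (h i)

/-- Every relative cochain corresponds to a form on `A`. -/
theorem exists_form_corresponds {c : (Fin k → 𝔩) → Cₛ^∞⟮𝓘(ℝ, EM); F, E⟯}
    (hc : c ∈ relativeCochains 𝔥 P.Ad B.ρ k) :
    ∃ η ∈ lieAlgebroidCochains (LHSpace.orbitSmooth H EM M) S.quotSections B.invSections k,
      B.Corresponds c η := by
  obtain ⟨⟨f, hf⟩, -, hH⟩ := id hc
  -- The form is $c$ evaluated on the lifts by `quotLift`; these are not equivariant, but the choice
  -- of representatives does not matter.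
  choose s hs _ using fun a : Fin k → S.quotSections =>
    B.exists_section_eval f.toMultilinearMap fun i => S.quotSections_lift (a i).2
  have hs' : ∀ a m (x : Fin k → 𝔩), (∀ i, 𝔥.toSubmodule.mkQ (x i) = (a i).1 m) →
      s a m = c x m := by
    intro a m x hx
    rw [hs, relativeCochains_congr hc fun i => (hx i).trans (LHSpace.mk_quotLift _).symm, hf]
    rfl
  -- If $x$ represents $a(mh)$, then $\mathrm{Ad}_h x$ represents $a(m)$, so $(h\, s_a)(m) = (h\,
  -- c(x))(m) = c(\mathrm{Ad}_h x)(m) = s_a(m)$.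
  have hinv : ∀ a, s a ∈ B.invSections := by
    intro a h
    ext m
    rw [B.ρ_apply, hs' a (op h • m) (fun i => LHSpace.quotLift 𝔥 ((a i).1 (op h • m)))
      fun i => LHSpace.mk_quotLift _, ← B.ρ_apply, ← hH]
    exact (hs' a m _ fun i => S.mk_Ad_of_quotSections (a i).2 m h (LHSpace.mk_quotLift _)).symm
  -- A free choice of representative in slot `i` lets linearity over $C^\infty(M/H)$ be read off,
  -- point by point, from real linearity of `f`.
  have hupd : ∀ (a : Fin k → S.quotSections) (i : Fin k) (b : S.quotSections) (m : M) (x : 𝔩),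
      𝔥.toSubmodule.mkQ x = b.1 m → s (Function.update a i b) m =
        f (Function.update (fun i => LHSpace.quotLift 𝔥 ((a i).1 m)) i x) m := by
    intro a i b m x hx
    rw [← hf]
    refine hs' _ m _ fun j => ?_
    rcases eq_or_ne j i with rfl | hij
    · simpa using hx
    · simpa [hij] using LHSpace.mk_quotLift ((a j).1 m)
  let φ : S.quotSections [⋀^Fin k]→ₗ[LHSpace.orbitSmooth H EM M] B.invSections :=
    { toFun := fun a => ⟨s a, hinv a⟩
      map_update_add' := fun [inst : DecidableEq (Fin k)] a i b b' => B.sec_ext fun m => by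
        obtain rfl : inst = instDecidableEqFin k := Subsingleton.elim _ _
        have hb := LHSpace.mk_quotLift (b.1 m)
        have hb' := LHSpace.mk_quotLift (b'.1 m)
        change s _ m = s _ m + s _ m
        rw [hupd a i b m _ hb, hupd a i b' m _ hb', hupd a i (b + b') m
          (LHSpace.quotLift 𝔥 (b.1 m) + LHSpace.quotLift 𝔥 (b'.1 m))
          (by rw [map_add, hb, hb']; rfl), f.map_update_add]
        rfl
      map_update_smul' := fun [inst : DecidableEq (Fin k)] a i t b => B.sec_ext fun m => by
        obtain rfl : inst = instDecidableEqFin k := Subsingleton.elim _ _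
        have hb := LHSpace.mk_quotLift (b.1 m)
        change s _ m = LHSpace.pull t m • s _ m
        rw [hupd a i b m _ hb, hupd a i (t • b) m (LHSpace.pull t m • LHSpace.quotLift 𝔥 (b.1 m))
          (by rw [map_smul, hb]; rfl), f.map_update_smul]
        rfl
      map_eq_zero_of_eq' := fun a i j hij hne => B.sec_ext fun m => by
        change s a m = 0
        rw [hs]
        exact congrArg (fun t : Cₛ^∞⟮𝓘(ℝ, EM); F, E⟯ => t m)
          (f.map_eq_zero_of_eq _ (by simp only [hij]) hne) }
  exact ⟨φ, ⟨φ, fun _ => rfl⟩, fun a x m hx => hs' a m x hx⟩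

end LHBundle

end Correspondence

/-! ### From forms on $A$ to relative cochains; the differentials -/

section Correspondence

variable {𝔩 : Type*} [LieRing 𝔩] [LieAlgebra ℝ 𝔩] [FiniteDimensional ℝ 𝔩] {𝔥 : LieSubalgebra ℝ 𝔩}
  {EH : Type*} [NormedAddCommGroup EH] [NormedSpace ℝ EH] [FiniteDimensional ℝ EH]
  {H : Type*} [TopologicalSpace H] [ChartedSpace EH H] [Group H] [LieGroup 𝓘(ℝ, EH) ∞ H]
  [T2Space H] [SecondCountableTopology H] {P : LieGroupPair 𝔥 EH H}
  {EM : Type*} [NormedAddCommGroup EM] [NormedSpace ℝ EM] [FiniteDimensional ℝ EM]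
  {M : Type*} [TopologicalSpace M] [ChartedSpace EM M] [IsManifold 𝓘(ℝ, EM) ∞ M]
  [T2Space M] [MulAction Hᵐᵒᵖ M]
  {S : LHSpace P EM M}
  {F : Type*} [NormedAddCommGroup F] [NormedSpace ℝ F]
  {E : M → Type*} [TopologicalSpace (TotalSpace F E)] [∀ m, TopologicalSpace (E m)]
  [FiberBundle F E] [∀ m, AddCommGroup (E m)] [∀ m, Module ℝ (E m)] [VectorBundle ℝ F E]
  [LieRingModule 𝔩 Cₛ^∞⟮𝓘(ℝ, EM); F, E⟯] [LieModule ℝ 𝔩 Cₛ^∞⟮𝓘(ℝ, EM); F, E⟯]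
  (B : LHBundle F E S) {k : ℕ}

namespace LHBundle

variable {B}

/-- Sections of `E` that are given pointwise by the values of a form on `A` at constant arguments
are smooth. -/
theorem contMDiff_fibre_form [ProperSMul Hᵐᵒᵖ M]
    (hfree : ∀ (m : M) (h : H), op h • m = m → h = 1)
    {η : (Fin k → S.quotSections) → B.invSections}
    {α : (m : M) → (𝔩 ⧸ 𝔥.toSubmodule) [⋀^Fin k]→ₗ[ℝ] E m}
    (hα : ∀ (m : M) (a : Fin k → S.quotSections), (η a).1 m = α m fun i => (a i).1 m)
    (v : Fin k → 𝔩 ⧸ 𝔥.toSubmodule) :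
    ContMDiff 𝓘(ℝ, EM) (𝓘(ℝ, EM).prod 𝓘(ℝ, F)) ∞
      (fun m => (⟨m, α m v⟩ : TotalSpace F E)) := by
  intro m₀
  obtain ⟨σ, hσ⟩ := S.exists_sections_through hfree m₀
  set b := Module.finBasis ℝ (𝔩 ⧸ 𝔥.toSubmodule)
  let e := fun i => σ (b i)
  let D : M → ℝ := fun m => b.det fun i => (e i).1 m
  have hD : ContMDiff 𝓘(ℝ, EM) 𝓘(ℝ, ℝ) ∞ D := SmoothInto.basis_det b fun i => (e i).2.1
  have hD₀ : D m₀ ≠ 0 := by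
    have : (fun i => (e i).1 m₀) = b := funext fun i => hσ (b i)
    simp only [D, this, b.det_self]
    exact one_ne_zero
  -- Cramer's coefficients of the constant `v i` in the frame `e`, smooth near `m₀`. No correction
  -- by a density is needed, since these are functions on $M$ and not on $M/H$.
  let g : Fin k → Fin _ → M → ℝ := fun i j m =>
    (D m)⁻¹ * b.det (Function.update (fun i => (e i).1 m) j (v i))
  have hg : ∀ i j, ContMDiffAt 𝓘(ℝ, EM) 𝓘(ℝ, ℝ) ∞ (g i j) m₀ := by
    intro i j
    refine ((hD m₀).inv₀ hD₀).mul ?_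
    have h1 : ∀ l, SmoothInto EM
        (fun m => Function.update (fun i => (e i).1 m) j (v i) l) := by
      intro l
      rcases eq_or_ne l j with rfl | hl
      · simp only [Function.update_self]
        exact .const _
      · simp only [Function.update_of_ne hl]
        exact (e l).2.1
    exact SmoothInto.basis_det b h1 m₀
  -- Multilinear expansion in the frame reduces to the values of `η` on the sections `e j`, which
  -- are smooth.
  have hsum : ∀ m, D m ≠ 0 → α m v = ∑ J : Fin k → Fin _, (∏ i, g i (J i) m) •
      (η fun i => e (J i)).1 m := by
    intro m hm
    have h1 : v = fun i => ∑ j, g i j m • (e j).1 m := by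
      ext1 i
      have h2 := b.det_smul_eq_sum (fun i => (e i).1 m) (v i)
      simp only [g, mul_smul, ← Finset.smul_sum, ← h2]
      exact (inv_smul_smul₀ hm _).symm
    conv_lhs => rw [h1]
    refine ((α m).toMultilinearMap.map_sum _).trans (Finset.sum_congr rfl fun J _ => ?_)
    rw [hα]
    exact (α m).toMultilinearMap.map_smul_univ (fun i => g i (J i) m) fun i => (e (J i)).1 m
  refine ContMDiffAt.congr_of_eventuallyEq (f := fun m => (⟨m, ∑ J : Fin k → Fin _,
    (∏ i, g i (J i) m) • (η fun i => e (J i)).1 m⟩ : TotalSpace F E)) ?_ ?_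
  · refine ContMDiffAt.sum_section fun J _ => ?_
    exact ContMDiffAt.smul_section (contMDiffAt_finsetProd fun i _ => hg i (J i))
      ((η fun i => e (J i)).1.contMDiff m₀)
  · filter_upwards [hD.continuous.continuousAt.eventually_ne hD₀] with m hm
    rw [hsum m hm]

/-- Every form on `A` corresponds to a relative cochain. -/
theorem exists_relativeCochain_corresponds [ProperSMul Hᵐᵒᵖ M]
    (hfree : ∀ (m : M) (h : H), op h • m = m → h = 1)
    {η : (Fin k → S.quotSections) → B.invSections}
    (hη : η ∈ lieAlgebroidCochains (LHSpace.orbitSmooth H EM M) S.quotSections B.invSections k) :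
    ∃ c ∈ relativeCochains 𝔥 P.Ad B.ρ k, B.Corresponds c η := by
  obtain ⟨φ, hφ⟩ := hη
  obtain rfl : η = φ := funext hφ
  choose α hα using B.exists_fibre_form hfree φ
  let f : 𝔩 [⋀^Fin k]→ₗ[ℝ] Cₛ^∞⟮𝓘(ℝ, EM); F, E⟯ :=
    { toFun := fun x => ⟨_, contMDiff_fibre_form hfree hα fun i => 𝔥.toSubmodule.mkQ (x i)⟩
      map_update_add' := fun x i y z => ContMDiffSection.ext fun m =>
        ((α m).compLinearMap 𝔥.toSubmodule.mkQ).map_update_add x i y z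
      map_update_smul' := fun x i t y => ContMDiffSection.ext fun m =>
        ((α m).compLinearMap 𝔥.toSubmodule.mkQ).map_update_smul x i t y
      map_eq_zero_of_eq' := fun x i j hij hne => ContMDiffSection.ext fun m =>
        ((α m).compLinearMap 𝔥.toSubmodule.mkQ).map_eq_zero_of_eq x hij hne }
  have hf : ∀ x m, f x m = α m fun i => 𝔥.toSubmodule.mkQ (x i) := fun _ _ => rfl
  have hcorr : B.Corresponds f φ := fun a x m hx => by
    rw [hf, hα]
    simp only [hx]
  refine ⟨f, ⟨⟨f, fun _ => rfl⟩, fun x ⟨i, hi⟩ => ContMDiffSection.ext fun m => ?_,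
    fun h x => ContMDiffSection.ext fun m => ?_⟩, hcorr⟩
  · rw [hf]
    exact (α m).map_coord_zero i ((Submodule.Quotient.mk_eq_zero _).2 hi)
  -- Sections of $A$ through the classes of the `x i` at $mh$ have at $m$ the classes of
  -- $\mathrm{Ad}_h x_i$; equivariance of the cochain is then invariance of the value of `φ` on
  -- these sections.
  · obtain ⟨σ, hσ⟩ := S.exists_sections_through hfree (op h • m)
    have hx := fun i => (hσ (𝔥.toSubmodule.mkQ (x i))).symm
    rw [B.ρ_apply, ← hcorr _ x (op h • m) hx, ← B.ρ_apply, (φ _).2 h]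
    exact (hcorr _ _ m fun i =>
      S.mk_Ad_of_quotSections (σ (𝔥.toSubmodule.mkQ (x i))).2 m h (hx i)).symm

/-- The correspondence is compatible with the differentials. -/
theorem Corresponds.ceDifferential {c : (Fin k → 𝔩) → Cₛ^∞⟮𝓘(ℝ, EM); F, E⟯}
    {η : (Fin k → S.quotSections) → B.invSections} (h : B.Corresponds c η)
    (hc : c ∈ relativeCochains 𝔥 P.Ad B.ρ k) :
    B.Corresponds (ceDifferential 𝔩 _ k c) (ceDifferential S.quotSections _ k η) := by
  intro a x m hx
  obtain ⟨⟨f, hf⟩, -, -⟩ := id hc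
  cases k with
  | zero =>
    change (⁅a 0, η fun r => r.elim0⁆ : B.invSections).1 m =
      (⁅x 0, c fun r => r.elim0⁆ : Cₛ^∞⟮𝓘(ℝ, EM); F, E⟯) m
    rw [B.lie_apply _ _ m (hx 0)]
    -- The correspondence at all points is needed here, since the action differentiates the section.
    have : (η fun r => r.elim0).1 = c fun r => r.elim0 :=
      ContMDiffSection.ext fun m' => h _ _ m' fun r => r.elim0
    rw [this]
  | succ k =>
    obtain rfl : c = f := funext hf
    -- lifts of the `a i` with the prescribed values at `m`
    let l : Fin (k + 2) → M → 𝔩 := fun i m' =>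
      LHSpace.quotLift 𝔥 ((a i).1 m') + (x i - LHSpace.quotLift 𝔥 ((a i).1 m))
    have hl : ∀ i, SmoothInto EM (l i) := fun i => (S.quotSections_lift (a i).2).add (.const _)
    have hlx : ∀ i, l i m = x i := fun i => add_sub_cancel _ _
    have hla : ∀ i m', 𝔥.toSubmodule.mkQ (l i m') = (a i).1 m' := fun i m' => by
      rw [map_add, map_sub, hx, LHSpace.mk_quotLift, LHSpace.mk_quotLift, sub_self, add_zero]
    -- `y i j` is the derivative of the `j`-th lift along the anchor of the `i`-th.
    let y : Fin (k + 2) → Fin (k + 2) → 𝔩 := fun i j => dirDeriv (l j) m (S.lam (x i) m)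
    have h1 : ∀ j : Fin (k + 2), (⁅a j, η fun r => a (j.succAbove r)⁆ : B.invSections).1 m =
        (⁅x j, f fun r => x (j.succAbove r)⁆ : Cₛ^∞⟮𝓘(ℝ, EM); F, E⟯) m +
        ∑ r, f (Function.update (fun r => x (j.succAbove r)) r (y j (j.succAbove r))) m := by
      intro j
      obtain ⟨s, hs, hs'⟩ := B.exists_section_eval f.toMultilinearMap
        fun r => hl (j.succAbove r)
      have : (η fun r => a (j.succAbove r)).1 = s := ContMDiffSection.ext fun m' =>
        (h _ _ m' fun r => hla (j.succAbove r) m').trans (hs m').symm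
      rw [B.lie_apply _ _ m (hx j), this, hs']
      simp only [hlx]
      rfl
    -- The bracket of $A$ may be computed with any smooth lifts, in particular with `l i` and `l j`,
    -- which have the values `x i` and `x j` at `m`.
    have h2 : ∀ i j : Fin (k + 2), 𝔥.toSubmodule.mkQ (⁅x i, x j⁆ + (y i j - y j i)) =
        (⁅a i, a j⁆ : S.quotSections).1 m := by
      intro i j
      refine Eq.trans ?_ (S.quotBracket_eq (a i).2 (a j).2 (hl i) (hl j) (hla i) (hla j) m).symm
      simp only [LHSpace.transBracket, LHSpace.anchorDeriv, hlx, y]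
      rw [add_sub_assoc]
    have h3 : ∀ (i : Fin (k + 1)) (j : Fin (k + 2)),
        (η (Fin.cons ⁅a i.castSucc, a j⁆ fun r => a (j.succAbove (i.succAbove r)))).1 m =
        f (Fin.cons ⁅x i.castSucc, x j⁆ fun r => x (j.succAbove (i.succAbove r))) m +
        f (Fin.cons (y i.castSucc j - y j i.castSucc)
          fun r => x (j.succAbove (i.succAbove r))) m := by
      intro i j
      rw [h (Fin.cons ⁅a i.castSucc, a j⁆ fun r => a (j.succAbove (i.succAbove r)))
        (Fin.cons (⁅x i.castSucc, x j⁆ + (y i.castSucc j - y j i.castSucc))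
        fun r => x (j.succAbove (i.succAbove r))) m
        (Fin.cases (h2 i.castSucc j) fun r => hx (j.succAbove (i.succAbove r)))]
      exact congrArg (evalAt F m) (f.toMultilinearMap.cons_add _ _ _)
    have h4 := ((evalAt F m).compAlternatingMap f).sum_update_add_sum_cons_eq_zero x y
    let ev : B.invSections →ₗ[ℝ] E m := evalAt F m ∘ₗ B.invSections.subtype
    change ev (_ + _) = evalAt F m (_ + _)
    simp only [map_add, map_sum, map_smul, apply_ite ev, apply_ite (evalAt F m), map_zero]
    have hev : ∀ s : B.invSections, ev s = s.1 m := fun _ => rfl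
    have hev' : ∀ s : Cₛ^∞⟮𝓘(ℝ, EM); F, E⟯, evalAt F m s = s m := fun _ => rfl
    have hev'' : ∀ z, (evalAt F m).compAlternatingMap f z = f z m := fun _ => rfl
    simp only [hev, hev', h1, h3, smul_add, Finset.sum_add_distrib, ite_add_zero]
    simp only [hev''] at h4
    -- The terms in `y` from the product rule and from the brackets are collected and cancel.
    rw [add_add_add_comm, h4, add_zero]

end LHBundle

end Correspondence

/-! ### The isomorphism in cohomology -/

/-- A linear one-to-one correspondence between two submodules induces an isomorphism of the
quotients by corresponding submodules. -/
theorem nonempty_quotient_linearEquiv_of_correspondence {K X Y : Type*} [CommRing K]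
    [AddCommGroup X] [Module K X] [AddCommGroup Y] [Module K Y] {Z N : Submodule K X}
    {Z' N' : Submodule K Y} (R : X → Y → Prop)
    (hadd : ∀ x x' y y', R x y → R x' y' → R (x + x') (y + y'))
    (hsmul : ∀ (t : K) (x : X) (y : Y), R x y → R (t • x) (t • y))
    (hr : ∀ x y y', R x y → R x y' → y = y') (hl : ∀ x x' y, R x y → R x' y → x = x')
    (hZ : ∀ x ∈ Z, ∃ y ∈ Z', R x y) (hZ' : ∀ y ∈ Z', ∃ x ∈ Z, R x y)
    (hN : ∀ x ∈ N, ∀ y, R x y → y ∈ N') (hN' : ∀ y ∈ N', ∀ x, R x y → x ∈ N) :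
    Nonempty ((Z ⧸ N.comap Z.subtype) ≃ₗ[K] (Z' ⧸ N'.comap Z'.subtype)) := by
  choose f hf hfR using hZ
  let φ : Z →ₗ[K] Z' :=
    { toFun := fun x => ⟨f x x.2, hf x x.2⟩
      map_add' := fun x x' => Subtype.ext
        (hr _ _ _ (hfR _ _) (hadd _ _ _ _ (hfR x x.2) (hfR x' x'.2)))
      map_smul' := fun t x => Subtype.ext (hr _ _ _ (hfR _ _) (hsmul t _ _ (hfR x x.2))) }
  have hφ : Function.Bijective φ := by
    refine ⟨fun x x' h => Subtype.ext (hl _ _ _ (hfR x x.2) ?_), fun y => ?_⟩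
    · have h' : f x x.2 = f x' x'.2 := congrArg Subtype.val h
      rw [h']
      exact hfR x' x'.2
    · obtain ⟨x, hx, hxy⟩ := hZ' y y.2
      exact ⟨⟨x, hx⟩, Subtype.ext (hr _ _ _ (hfR x hx) hxy)⟩
  refine ⟨Submodule.Quotient.equiv _ _ (LinearEquiv.ofBijective φ hφ) (le_antisymm ?_ ?_)⟩
  · rintro _ ⟨x, hx, rfl⟩
    exact hN _ hx _ (hfR x x.2)
  · intro y hy
    obtain ⟨x, rfl⟩ := hφ.2 y
    exact ⟨x, hN' _ hy _ (hfR x x.2), rfl⟩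

theorem mainTheorem4
    {𝔩 : Type*} [LieRing 𝔩] [LieAlgebra ℝ 𝔩] [FiniteDimensional ℝ 𝔩] {𝔥 : LieSubalgebra ℝ 𝔩}
    {EH : Type*} [NormedAddCommGroup EH] [NormedSpace ℝ EH] [FiniteDimensional ℝ EH]
    {H : Type*} [TopologicalSpace H] [ChartedSpace EH H] [Group H] [LieGroup 𝓘(ℝ, EH) ∞ H]
    [T2Space H] [SecondCountableTopology H]
    (P : LieGroupPair 𝔥 EH H)
    {EM : Type*} [NormedAddCommGroup EM] [NormedSpace ℝ EM] [FiniteDimensional ℝ EM]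
    {M : Type*} [TopologicalSpace M] [ChartedSpace EM M] [IsManifold 𝓘(ℝ, EM) ∞ M]
    [T2Space M] [SecondCountableTopology M]
    [MulAction Hᵐᵒᵖ M] [ProperSMul Hᵐᵒᵖ M]
    (hfree : ∀ (m : M) (h : H), op h • m = m → h = 1)
    (S : LHSpace P EM M)
    {F : Type*} [NormedAddCommGroup F] [NormedSpace ℝ F] [FiniteDimensional ℝ F]
    {E : M → Type*} [TopologicalSpace (TotalSpace F E)] [∀ m, TopologicalSpace (E m)]
    [FiberBundle F E] [∀ m, AddCommGroup (E m)] [∀ m, Module ℝ (E m)] [VectorBundle ℝ F E]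
    [ContMDiffVectorBundle ∞ F E 𝓘(ℝ, EM)]
    [LieRingModule 𝔩 Cₛ^∞⟮𝓘(ℝ, EM); F, E⟯] [LieModule ℝ 𝔩 Cₛ^∞⟮𝓘(ℝ, EM); F, E⟯]
    (B : LHBundle F E S) (k : ℕ) :
    Nonempty (LieAlgebroidCohomology (LHSpace.orbitSmooth H EM M) S.quotSections B.invSections k
      ≃ₗ[ℝ] RelativeLieCohomology 𝔥 P.Ad B.ρ k) := by
  have h0 : ∀ k, B.Corresponds (0 : (Fin k → 𝔩) → Cₛ^∞⟮𝓘(ℝ, EM); F, E⟯) 0 :=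
    fun k a x m hx => rfl
  suffices h : Nonempty (RelativeLieCohomology 𝔥 P.Ad B.ρ k ≃ₗ[ℝ]
      LieAlgebroidCohomology (LHSpace.orbitSmooth H EM M) S.quotSections B.invSections k) from
    h.map LinearEquiv.symm
  -- Cocycles and coboundaries have to be matched in both directions. Coboundaries are not required
  -- to be cocycles here, so $d \circ d = 0$ does not enter.
  refine nonempty_quotient_linearEquiv_of_correspondence B.Corresponds
    (fun _ _ _ _ h h' => h.add h') (fun t _ _ h => h.smul t) (fun _ _ _ h h' => h.right_unique h')
    (fun _ _ _ h h' => h.left_unique hfree h') ?_ ?_ ?_ ?_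
  · rintro c ⟨hc, hdc⟩
    obtain ⟨η, hη, h⟩ := LHBundle.exists_form_corresponds hc
    refine ⟨η, ⟨hη, ?_⟩, h⟩
    -- $d\eta$ corresponds to $dc = 0$, and so does $0$; uniqueness gives $d\eta = 0$.
    have h1 := h.ceDifferential hc
    rw [LinearMap.mem_ker.1 hdc] at h1
    exact h1.right_unique (h0 _)
  · rintro η ⟨hη, hdη⟩
    obtain ⟨c, hc, h⟩ := LHBundle.exists_relativeCochain_corresponds hfree hη
    refine ⟨c, ⟨hc, ?_⟩, h⟩
    have h1 := h.ceDifferential hc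
    rw [LinearMap.mem_ker.1 hdη] at h1
    exact h1.left_unique hfree (h0 _)
  · intro c hc η h
    cases k with
    | zero =>
      obtain rfl : c = 0 := hc
      exact h.right_unique (h0 _)
    | succ k =>
      obtain ⟨c', hc', rfl⟩ := hc
      obtain ⟨η', hη', h'⟩ := LHBundle.exists_form_corresponds hc'
      -- Both $d\eta'$ and $\eta$ correspond to $dc'$, so they agree.
      exact ⟨η', hη', (h'.ceDifferential hc').right_unique h⟩
  · intro η hη c h
    cases k with
    | zero =>
      obtain rfl : η = 0 := hη
      exact h.left_unique hfree (h0 _)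
    | succ k =>
      obtain ⟨η', hη', rfl⟩ := hη
      obtain ⟨c', hc', h'⟩ := LHBundle.exists_relativeCochain_corresponds hfree hη'
      exact ⟨c', hc', (h'.ceDifferential hc').left_unique hfree h⟩
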